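/- Setting. Let $n\ge 1$. For $f\in L^2(\mathbb R^n)$ let $e^{it\Delta}f(x)=(2\pi)^{-n}\int e^{i(x\cdot\xi+t|\xi|^2)}\widehat f(\xi)\,d\xi$ with $\widehat f(\xi)=\int e^{-ix\cdot\xi}f(x)\,dx$. Let $k,A$ be integers with $1\le k\le n+2$, $A\ge 0$, let $1\le p,r<\infty$, $K,M,R>0$ and $\xi_0\in\mathbb R^n$. Let $B(\xi_0,M^{-1})$ be covered by finitely many measurable pieces $\tau$ of positive measure, disjoint up to null sets, each contained in a ball of radius $(KM)^{-1}$; let $B(0,R)\subset\mathbb R^n$ be covered by finitely many measurable sets $B_K$ of positive measure, each contained in a ball of radius $K$; let $[0,R]$ be covered by finitely many intervals $I_K$ of positive length at most $K$. Let $G(\tau)=\{(-2\xi,1)/|(-2\xi,1)| : \xi\in\tau\}$, let $\mathrm{Angle}(G(\tau),V)$ be the smallest (infimum) angle between a vector of $G(\tau)$ and a nonzero vector of the subspace $V$ ($+\infty$ if there are none), and let $f_\tau$ be defined by $\widehat{f_\tau}=\mathbf 1_\tau\widehat f$. Put $$\mu_{e^{it\Delta}f}(B_K\times I_K)=\min_{V_1,\dots,V_A}\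 \max_{\tau:\ \mathrm{Angle}(G(\tau),V_a)>(KM)^{-1}\ \forall a}\ \int_{B_K\times I_K}|e^{it\Delta}f_\tau(x)|^p\,dx\,dt,$$ where $V_1,\dots,V_A$ range over the $(k-1)$-dimensional subspaces of $\mathbb R^n\times\mathbb R$ and the maximum over no $\tau$ is $0$, and for $U\subset B(0,R)\times[0,R]$ (with $|\cdot|$ the Lebesgue, in general outer, measure) $$\|e^{it\Delta}f\|_{BL^p_{k,A}L^r(U)}^p=\sum_{B_K}\Big[\sum_{I_K}\Big(\frac{|U\cap(B_K\times I_K)|}{|B_K\times I_K|}\,\mu_{e^{it\Delta}f}(B_K\times I_K)\Big)^r\Big]^{1/r}.$$ For real polynomials on $\mathbb R^n\times\mathbb R$, the common zero set $Z(P_1,\dots,P_m)$ is called a transverse complete intersection if $\nabla P_1\wedge\dots\wedge\nabla P_m\ne 0$ at each of its points. Theorem 4.5. There is a constant $c_n>0$ depending only on $n$ such that the following holds for all data as above. Let $f\in L^2(\mathbb R^n)$ with $\operatorname{supp}\widehat f\subset B(\xi_0,M^{-1})$ (for instance $\operatorname{supp}\widehat f\subset B(0,1)$, with $\xi_0=0$,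 $M=1$), let $U\subset B(0,R)\times[0,R]$, and let $D\ge 1$. Then there are an integer $s\ge0$ and real polynomials $Q_1,\dots,Q_s$ on $\mathbb R^n\times\mathbb R$ with $$\sum_{l=1}^s\deg Q_l\le D,\qquad c_n^{-1}D^{n+1}\le 2^s\le c_nD^{n+1},$$ and with the following properties. For $c=(c_1,\dots,c_s)\in\mathbb R^s$ put $\tilde Q_l=Q_l+c_l$ and $P=\prod_{l=1}^s\tilde Q_l$, and for each of the $2^s$ choices of signs $\sigma\in\{+,-\}^s$ let $O_\sigma$ be the set where every $\tilde Q_l$ has the sign $\sigma_l$. (i) For every $c\in\mathbb R^s$ the cells $O_\sigma$ are open and pairwise disjoint, and $(\mathbb R^n\times\mathbb R)\setminus Z(P)=\bigcup_\sigma O_\sigma$. (ii) There is $\delta>0$ such that, whenever $|c_l|<\delta$ for all $l$, all $2^s$ cells $O_\sigma$ are nonempty and each of them satisfies $$\|e^{it\Delta}f\|_{BL^p_{k,A}L^r(U)}^p\le c_nD^{n+1}\,\|e^{it\Delta}f\|_{BL^p_{k,A}L^r(U\cap O_\sigma)}^p .$$ (iii) For almost every $c\in\mathbb R^s$, each $Z(Q_l+c_l)$,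 $1\le l\le s$, is a transverse complete intersection. -/

import Mathlib

open MeasureTheory FourierTransform

noncomputable section

namespace BroadPartition

/-- The space `ℝⁿ` with its Euclidean norm. Space-time `ℝⁿ × ℝ` is `Space n × ℝ`. -/
abbrev Space (n : ℕ) : Type := EuclideanSpace ℝ (Fin n)

/-- The space `L²(ℝⁿ; ℂ)`. -/
abbrev L2 (n : ℕ) : Type := Lp (α := Space n) ℂ 2 volume

/-- A decomposition of a set `S` at scale `r`: finitely many measurable pieces of positive
measure which cover `S`, each of them contained in a closed ball of radius `r`.
The pieces may stick out of `S`, and may overlap (so that genuine balls of radius `r` as well as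
disjoint cube-like pieces are admitted); where disjointness is wanted it is asked for separately. -/
structure Decomposition {X : Type*} [PseudoMetricSpace X] [MeasureSpace X]
    (S : Set X) (r : ℝ) where
  /-- the number of pieces -/
  N : ℕ
  /-- the pieces -/
  piece : Fin N → Set X
  measurable_piece : ∀ j, MeasurableSet (piece j)
  volume_pos : ∀ j, 0 < volume (piece j)
  subset_ball : ∀ j, ∃ x, piece j ⊆ Metric.closedBall x r
  covers : S ⊆ ⋃ j, piece j

/-- The Fourier transform `f̂(ξ) = ∫ e^{-i x·ξ} f(x) dx` of `f ∈ L²(ℝⁿ)` (in the sense of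
Plancherel). Mathlib's transform has the kernel `e^{-2πi x·ξ}`, whence the dilation. -/
def hat {n : ℕ} (f : L2 n) (ξ : Space n) : ℂ :=
  (𝓕 f : L2 n) ((2 * Real.pi)⁻¹ • ξ)

/-- `e^{itΔ}g (x) = (2π)^{-n} ∫ e^{i(x·ξ + t|ξ|²)} ĝ(ξ) dξ`, as a function of `z = (x, t)`;
the argument `G` is the Fourier transform `ĝ`. -/
def evolution {n : ℕ} (G : Space n → ℂ) (z : Space n × ℝ) : ℂ :=
  (((2 * Real.pi) ^ n)⁻¹ : ℝ) *
    ∫ ξ : Space n, Complex.exp (Complex.I * ((inner ℝ z.1 ξ + z.2 * ‖ξ‖ ^ 2 : ℝ) : ℂ)) * G ξ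

/-- `e^{itΔ} f_τ`, where `f_τ` is the function whose Fourier transform is `f̂` restricted
to `τ`. -/
def evolutionPiece {n : ℕ} (f : L2 n) (τ : Set (Space n)) : Space n × ℝ → ℂ :=
  evolution (τ.indicator (hat f))

/-- The vector `(-2ξ, 1)` in the Euclidean space `ℝⁿ × ℝ`. -/
def directionVec {n : ℕ} (ξ : Space n) : WithLp 2 (Space n × ℝ) :=
  WithLp.toLp 2 ((-2 : ℝ) • ξ, (1 : ℝ))

/-- `G(ξ) = (-2ξ, 1) / |(-2ξ, 1)|`. -/
def direction {n : ℕ} (ξ : Space n) : WithLp 2 (Space n × ℝ) :=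
  ‖directionVec ξ‖⁻¹ • directionVec ξ

/-- `Angle(G(τ), V)`: the smallest (infimum) angle between a nonzero vector of the subspace `V`
and a vector of `G(τ) = {G(ξ) | ξ ∈ τ}`; it is `∞` if there are no such vectors. -/
def capAngle {n : ℕ} (τ : Set (Space n)) (V : Submodule ℝ (WithLp 2 (Space n × ℝ))) : ENNReal :=
  ⨅ v ∈ {v : WithLp 2 (Space n × ℝ) | v ∈ V ∧ v ≠ 0}, ⨅ w ∈ direction '' τ,
    ENNReal.ofReal (InnerProductGeometry.angle v w)

/-- The quantity `μ_{e^{itΔ}f}(W)` for a space-time set `W = B_K × I_K`: the minimum over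
`(k-1)`-dimensional subspaces `V_1, …, V_A` of the maximum, over those pieces `τ` with
`Angle(G(τ), V_a) > (KM)⁻¹` for all `a`, of `∫_W |e^{itΔ} f_τ|^p`.
(Only finitely many values occur, so the infimum is a minimum; a maximum over no `τ` is `0`.) -/
def broadMass {n : ℕ} (k A : ℕ) (p K M : ℝ) {S : Set (Space n)}
    (τ : Decomposition S (K * M)⁻¹) (f : L2 n) (W : Set (Space n × ℝ)) : ℝ :=
  ⨅ V : Fin A → {V : Submodule ℝ (WithLp 2 (Space n × ℝ)) // Module.finrank ℝ V = k - 1},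
    ⨆ j : {j : Fin τ.N // ∀ a, ENNReal.ofReal (K * M)⁻¹ < capAngle (τ.piece j) (V a).1},
      ∫ z in W, ‖evolutionPiece f (τ.piece j.1) z‖ ^ p

/-- The `p`-th power `‖e^{itΔ}f‖_{BL^p_{k,A} L^r(U)}^p` of the broad norm,
`∑_{B_K} [ ∑_{I_K} ( |U ∩ (B_K × I_K)| / |B_K × I_K| · μ_{e^{itΔ}f}(B_K × I_K) )^r ]^{1/r}`. -/
def broadNormPow {n : ℕ} (k A : ℕ) (p r K M : ℝ) {S : Set (Space n)} {S' : Set (Space n)}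
    {T : Set ℝ} (τ : Decomposition S (K * M)⁻¹) (B : Decomposition S' K)
    (I : Decomposition T (K / 2)) (f : L2 n) (U : Set (Space n × ℝ)) : ℝ :=
  ∑ b, (∑ i, (volume.real (U ∩ B.piece b ×ˢ I.piece i) / volume.real (B.piece b ×ˢ I.piece i) *
    broadMass k A p K M τ f (B.piece b ×ˢ I.piece i)) ^ r) ^ (1 / r)

/-- Coordinates `(x_1, …, x_n, t)` of a point of space-time. -/
def coords {n : ℕ} (z : Space n × ℝ) : Fin (n + 1) → ℝ :=
  Fin.snoc (α := fun _ => ℝ) (fun i => z.1 i) z.2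

/-- The value `P(x, t)` of a real polynomial in the `n + 1` variables `x_1, …, x_n, t`. -/
def value {n : ℕ} (P : MvPolynomial (Fin (n + 1)) ℝ) (z : Space n × ℝ) : ℝ :=
  MvPolynomial.eval (coords z) P

/-- The common zero set `Z(P_1, …, P_m)`. -/
def zeroSet {n m : ℕ} (P : Fin m → MvPolynomial (Fin (n + 1)) ℝ) : Set (Space n × ℝ) :=
  {z | ∀ i, value (P i) z = 0}

/-- `Z(P_1, …, P_m)` is a transverse complete intersection: `∇P_1(z) ∧ ⋯ ∧ ∇P_m(z) ≠ 0`, that is,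
the gradients are linearly independent, at every point `z` of it. -/
def IsTransverseCompleteIntersection {n m : ℕ} (P : Fin m → MvPolynomial (Fin (n + 1)) ℝ) : Prop :=
  ∀ z ∈ zeroSet P, LinearIndependent ℝ
    (fun (i : Fin m) (j : Fin (n + 1)) => value (MvPolynomial.pderiv j (P i)) z)

/-- The perturbed polynomials `Q_l + c_l`. -/
def perturb {n s : ℕ} (Q : Fin s → MvPolynomial (Fin (n + 1)) ℝ) (c : Fin s → ℝ) :
    Fin s → MvPolynomial (Fin (n + 1)) ℝ :=
  fun l => Q l + MvPolynomial.C (c l)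

/-- The cell of the polynomials `P_1, …, P_s` with the sign condition `σ`: `P_l > 0` where
`σ_l` is `true`, and `P_l < 0` where `σ_l` is `false`. -/
def cell {n s : ℕ} (P : Fin s → MvPolynomial (Fin (n + 1)) ℝ) (σ : Fin s → Bool) :
    Set (Space n × ℝ) :=
  {z | ∀ l, if σ l = true then 0 < value (P l) z else value (P l) z < 0}

end BroadPartition

end

open BroadPartition

/-!
The broad norm enters only through two properties: `‖e^{itΔ}f‖^p` on `U ∩ E` is a continuous
function of the finitely many numbers `|U ∩ E ∩ (B_K × I_K)|`, and by Minkowski's inequality in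
`ℓ^r` it is subadditive in them. Hence, if a polynomial `Q` makes the norms on the two sets
`{Q > 0}` and `{Q < 0}` equal, each of them is at least half of the norm on the union; zero sets of polynomials are
null sets and contribute nothing. By the Borsuk–Ulam theorem on the sphere of coefficients, one
polynomial of degree `O(2^(l/(n+1)))` does this inside all of `2^l` given cells at once, since the
space of such polynomials has dimension greater than `2^l` (`exists_bisecting_polynomial`). After
`s` steps every one of the `2^s` cells carries at least `2^(-s)` of the norm, and the degrees add
up to `O(2^(s/(n+1)))` (`exists_partitioning_polynomials`, `sum_two_pow_div`).

The masses of the cells depend continuously on the polynomials (`tendsto_measure_cell`), so a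
factor `2` in the inequality leaves room for two perturbations. The first adds `η ∑ xⱼ^d` with `d`
large to each polynomial; then the partial derivatives generate an ideal of finite codimension, so
there are finitely many critical values, and almost every constant term makes the zero set smooth
(`finite_criticalValues_add_pow`, `ae_isTransverse_perturb`). The second is the change of the
constant terms. If the norm on `U` vanishes, only the nonemptiness of the cells is at stake, and
the partition is taken for the volume of a ball instead (`exists_partition_broadNormPow`).

The Borsuk–Ulam theorem is proved algebraically. An odd continuous map from the sphere `∑ xₒ² = 1`
in `ℝ^(m+1)` to `ℝ^m` is approximated by odd polynomials `Fᵢ`, and it is enough to find a point of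
the sphere with `xᵢ^d + Fᵢ(x) / ε = 0` for `i = 1, …, m`, where `d` is odd and large, since then
`|Fᵢ(x)| ≤ ε`. With a suitable weight the leading terms of these equations and of the equation of
the sphere are `x₁^d, …, x_m^d, x₀²`. So the monomials `x₀^a ∏ xᵢ^(bᵢ)` with `a < 2` and `bᵢ < d`
are a basis of the quotient of the polynomial ring (`linearIndependent_divMonomial`,
`restrictSupport_le_span_divMonomial`), and those of even degree, `d^m` in number, are a basis of
the quotient of the algebra of even polynomials. As `d^m` is odd and the residue fields are `ℝ` or
`ℂ`, this quotient has a real character (`exists_algHom_real_of_odd_finrank`). A real character of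
the even polynomials that takes the value `1` at `∑ xₒ²` is the evaluation at a pair of antipodal
real points of the sphere (`exists_point_of_even_algHom`).
-/

namespace PolynomialPartition

open MvPolynomial BroadPartition Filter Topology

/-! ### Dividing monomials by polynomials with separate leading powers -/

section Triangular

variable {σ R : Type*} [CommRing R]

/-- The polynomials all of whose monomials have weight less than `N`. -/
noncomputable def weightLT (R : Type*) [CommRing R] (w : σ → ℕ) (N : ℕ) :
    Submodule R (MvPolynomial σ R) :=
  restrictSupport R {c | Finsupp.weight w c < N}

/-- `p` is the monomial `x^c` plus terms of smaller weight. -/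
def HasLeading (w : σ → ℕ) (p : MvPolynomial σ R) (c : σ →₀ ℕ) : Prop :=
  p - monomial c 1 ∈ weightLT R w (Finsupp.weight w c)

theorem hasLeading_monomial (w : σ → ℕ) (c : σ →₀ ℕ) :
    HasLeading w (monomial c (1 : R)) c := by
  simp [HasLeading]

open scoped Pointwise in
theorem mul_mem_restrictSupport {s t u : Set (σ →₀ ℕ)} {p q : MvPolynomial σ R}
    (hp : p ∈ restrictSupport R s) (hq : q ∈ restrictSupport R t)
    (h : ∀ a ∈ s, ∀ b ∈ t, a + b ∈ u) : p * q ∈ restrictSupport R u := by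
  refine restrictSupport_mono (s := s + t) R ?_ ?_
  · rintro _ ⟨a, ha, b, hb, rfl⟩
    exact h a ha b hb
  · rw [restrictSupport_add]
    exact Submodule.mul_mem_mul hp hq

theorem HasLeading.mul {w : σ → ℕ} {p q : MvPolynomial σ R} {c d : σ →₀ ℕ}
    (hp : HasLeading w p c) (hq : HasLeading w q d) : HasLeading w (p * q) (c + d) := by
  unfold HasLeading weightLT at *
  have key : p * q - monomial (c + d) 1 = (p - monomial c 1) * (q - monomial d 1)
      + (p - monomial c 1) * monomial d 1 + monomial c 1 * (q - monomial d 1) := by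
    have : (monomial (c + d) (1 : R)) = monomial c 1 * monomial d 1 := by simp [monomial_mul]
    rw [this]; ring
  rw [key]
  have hd : (monomial d (1 : R)) ∈ restrictSupport R {d} := by simp
  have hc : (monomial c (1 : R)) ∈ restrictSupport R {c} := by simp
  refine add_mem (add_mem ?_ ?_) ?_
  · refine mul_mem_restrictSupport hp hq fun a ha b hb => ?_
    simp only [Set.mem_ofPred_eq, map_add] at *; omega
  · refine mul_mem_restrictSupport hp hd fun a ha b hb => ?_
    simp only [Set.mem_ofPred_eq, Set.mem_singleton_iff, map_add] at *; subst hb; omega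
  · refine mul_mem_restrictSupport hc hq fun a ha b hb => ?_
    simp only [Set.mem_ofPred_eq, Set.mem_singleton_iff, map_add] at *; subst ha; omega

theorem HasLeading.pow {w : σ → ℕ} {p : MvPolynomial σ R} {c : σ →₀ ℕ}
    (hp : HasLeading w p c) (k : ℕ) : HasLeading w (p ^ k) (k • c) := by
  induction k with
  | zero => simpa using hasLeading_monomial w (0 : σ →₀ ℕ)
  | succ k ih => rw [pow_succ, succ_nsmul]; exact ih.mul hp

theorem HasLeading.prod {ι : Type*} (s : Finset ι) {w : σ → ℕ} {p : ι → MvPolynomial σ R}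
    {c : ι → σ →₀ ℕ} (hp : ∀ i ∈ s, HasLeading w (p i) (c i)) :
    HasLeading w (∏ i ∈ s, p i) (∑ i ∈ s, c i) := by
  classical
  induction s using Finset.induction_on with
  | empty => simpa using hasLeading_monomial w (0 : σ →₀ ℕ)
  | insert i s hi ih =>
    rw [Finset.prod_insert hi, Finset.sum_insert hi]
    exact (hp i (by simp)).mul (ih fun j hj => hp j (by simp [hj]))

theorem HasLeading.coeff_eq [DecidableEq σ] {w : σ → ℕ} {p : MvPolynomial σ R} {c c₀ : σ →₀ ℕ}
    (hp : HasLeading w p c) (h : Finsupp.weight w c ≤ Finsupp.weight w c₀) :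
    coeff c₀ p = if c = c₀ then 1 else 0 := by
  have h1 : coeff c₀ (p - monomial c 1) = 0 := by
    by_contra hne
    have := hp (mem_support_iff.2 hne)
    simp only [Set.mem_ofPred_eq] at this
    omega
  rw [coeff_sub, coeff_monomial, sub_eq_zero] at h1
  exact h1

variable [Fintype σ]

/-- The exponent `c` is divided with remainder by `e`, and `x^c` is replaced by
`∏ᵢ gᵢ^(cᵢ / eᵢ) xᵢ^(cᵢ % eᵢ)`. -/
noncomputable def divMonomial (g : σ → MvPolynomial σ R) (e : σ → ℕ) (c : σ →₀ ℕ) :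
    MvPolynomial σ R :=
  ∏ i, (g i ^ (c i / e i) * X i ^ (c i % e i))

variable {w e : σ → ℕ} {g : σ → MvPolynomial σ R}

theorem hasLeading_divMonomial (hg : ∀ i, HasLeading w (g i) (Finsupp.single i (e i)))
    (c : σ →₀ ℕ) : HasLeading w (divMonomial g e c) c := by
  have h : HasLeading w (divMonomial g e c) (∑ i, Finsupp.single i (c i)) := by
    refine HasLeading.prod _ fun i _ => ?_
    have h1 := ((hg i).pow (c i / e i)).mul
      ((hasLeading_monomial (R := R) w (Finsupp.single i 1)).pow (c i % e i))
    have h2 : (c i / e i) • Finsupp.single i (e i) + (c i % e i) • Finsupp.single i 1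
        = Finsupp.single i (c i) := by
      rw [Finsupp.smul_single, Finsupp.smul_single, ← Finsupp.single_add]
      congr 1
      simp only [smul_eq_mul, mul_one]
      rw [mul_comm]
      exact Nat.div_add_mod _ _
    rwa [h2] at h1
  rwa [Finsupp.univ_sum_single] at h

theorem linearIndependent_divMonomial
    (hg : ∀ i, HasLeading w (g i) (Finsupp.single i (e i))) :
    LinearIndependent R (divMonomial g e) := by
  classical
  rw [linearIndependent_iff]
  intro l hl
  by_contra hne
  obtain ⟨c₀, hc₀, hmax⟩ := l.support.exists_max_image (Finsupp.weight w)
    (Finsupp.support_nonempty_iff.2 hne)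
  have h := congrArg (coeff c₀) hl
  rw [Finsupp.linearCombination_apply, Finsupp.sum, coeff_sum, coeff_zero,
    Finset.sum_eq_single c₀] at h
  · rw [coeff_smul, (hasLeading_divMonomial hg c₀).coeff_eq le_rfl] at h
    simp at h
    exact (Finsupp.mem_support_iff.1 hc₀) h
  · intro c hc hcc
    rw [coeff_smul, (hasLeading_divMonomial hg c).coeff_eq (hmax c hc), if_neg hcc, smul_zero]
  · intro h; exact absurd hc₀ h

theorem restrictSupport_le_span_divMonomial
    (hg : ∀ i, HasLeading w (g i) (Finsupp.single i (e i))) (E : Set (σ →₀ ℕ))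
    (hE : ∀ c ∈ E, divMonomial g e c ∈ restrictSupport R E) :
    restrictSupport R E ≤ Submodule.span R (divMonomial g e '' E) := by
  have key : ∀ N : ℕ, ∀ c ∈ E, Finsupp.weight w c = N →
      monomial c (1 : R) ∈ Submodule.span R (divMonomial g e '' E) := by
    intro N
    induction N using Nat.strong_induction_on with
    | _ N ih =>
      intro c hc hN
      have h1 : divMonomial g e c - monomial c 1 ∈
          restrictSupport R (E ∩ {a | Finsupp.weight w a < N}) := by
        have ha : divMonomial g e c - monomial c 1 ∈ restrictSupport R E :=
          sub_mem (hE c hc) (by simp [hc])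
        have hb := hasLeading_divMonomial hg c
        rw [mem_restrictSupport_iff] at *
        refine Set.subset_inter ha ?_
        rw [← hN]
        exact hb
      have h2 : restrictSupport R (E ∩ {a | Finsupp.weight w a < N}) ≤
          Submodule.span R (divMonomial g e '' E) := by
        rw [restrictSupport_eq_span, Submodule.span_le]
        rintro _ ⟨a, ⟨ha, haN⟩, rfl⟩
        exact ih _ haN a ha rfl
      have h3 : divMonomial g e c ∈ Submodule.span R (divMonomial g e '' E) :=
        Submodule.subset_span ⟨c, hc, rfl⟩
      simpa using sub_mem h3 (h2 h1)
  rw [restrictSupport_eq_span, Submodule.span_le]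
  rintro _ ⟨c, hc, rfl⟩
  exact key _ c hc rfl

theorem divMonomial_mem_span_range {c : σ →₀ ℕ} (hc : ∃ i, e i ≤ c i) (he : ∀ i, 0 < e i) :
    divMonomial g e c ∈ Ideal.span (Set.range g) := by
  classical
  obtain ⟨i, hi⟩ := hc
  rw [divMonomial, ← Finset.mul_prod_erase _ _ (Finset.mem_univ i)]
  refine Ideal.mul_mem_right _ _ (Ideal.mul_mem_right _ _ ?_)
  exact Ideal.pow_mem_of_mem _ (Ideal.subset_span (Set.mem_range_self i)) _ (Nat.div_pos hi (he i))

theorem divMonomial_of_lt {c : σ →₀ ℕ} (hc : ∀ i, c i < e i) :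
    divMonomial g e c = monomial c 1 := by
  rw [divMonomial, monomial_eq, C_1, one_mul, Finsupp.prod_fintype _ _ (by simp)]
  refine Finset.prod_congr rfl fun i _ => ?_
  rw [Nat.div_eq_of_lt (hc i), Nat.mod_eq_of_lt (hc i), pow_zero, one_mul]

theorem mul_divMonomial [DecidableEq σ] (he : ∀ i, 0 < e i) (i : σ) (c : σ →₀ ℕ) :
    g i * divMonomial g e c = divMonomial g e (c + Finsupp.single i (e i)) := by
  rw [divMonomial, divMonomial, ← Finset.mul_prod_erase _ _ (Finset.mem_univ i),
    ← Finset.mul_prod_erase _ _ (Finset.mem_univ i), ← mul_assoc]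
  congr 1
  · simp [Nat.add_div_right _ (he i), pow_succ]; ring
  · refine Finset.prod_congr rfl fun j hj => ?_
    have : i ≠ j := (Finset.ne_of_mem_erase hj).symm
    simp [this]

/-- The ideal generated by the `gᵢ` is spanned by those products that contain some `gᵢ`. -/
theorem span_range_le_span_divMonomial
    (hg : ∀ i, HasLeading w (g i) (Finsupp.single i (e i))) (he : ∀ i, 0 < e i)
    {p : MvPolynomial σ R} (hp : p ∈ Ideal.span (Set.range g)) :
    p ∈ Submodule.span R (divMonomial g e '' {c | ∃ i, e i ≤ c i}) := by
  classical
  have htop : ∀ q : MvPolynomial σ R, q ∈ Submodule.span R (divMonomial g e '' Set.univ) := by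
    intro q
    refine restrictSupport_le_span_divMonomial hg Set.univ (by simp) ?_
    simp
  rw [← Set.image_univ, Ideal.span, Submodule.mem_span_image_iff_exists_fun] at hp
  obtain ⟨t, -, a, rfl⟩ := hp
  refine sum_mem fun i _ => ?_
  generalize a i = q
  have hq := htop q
  induction hq using Submodule.span_induction with
  | mem x hx =>
    obtain ⟨c, -, rfl⟩ := hx
    rw [smul_eq_mul, mul_comm, mul_divMonomial he]
    exact Submodule.subset_span ⟨_, ⟨i, by simp⟩, rfl⟩
  | zero => simp
  | add x y _ _ hx hy => rw [add_smul]; exact add_mem hx hy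
  | smul r x _ hx => rw [smul_assoc]; exact Submodule.smul_mem _ _ hx

/-- If the leading terms of the `gᵢ` are powers of the separate variables, then the quotient by the
ideal which they generate is finite over the coefficients. -/
theorem finite_quotient_span_range (hg : ∀ i, HasLeading w (g i) (Finsupp.single i (e i)))
    (he : ∀ i, 0 < e i) : Module.Finite R (MvPolynomial σ R ⧸ Ideal.span (Set.range g)) := by
  classical
  have hfin : {c : σ →₀ ℕ | ∀ i, c i < e i}.Finite := by
    refine (Set.finite_Iic (Finsupp.equivFunOnFinite.symm e)).subset fun c hc i => ?_
    exact (hc i).le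
  refine ⟨⟨(hfin.image fun c => Ideal.Quotient.mk (Ideal.span (Set.range g))
    (divMonomial g e c)).toFinset, ?_⟩⟩
  rw [eq_top_iff]
  rintro x -
  obtain ⟨p, rfl⟩ := Ideal.Quotient.mk_surjective x
  have hp : p ∈ Submodule.span R (divMonomial g e '' Set.univ) :=
    restrictSupport_le_span_divMonomial hg Set.univ (by simp) (by simp)
  induction hp using Submodule.span_induction with
  | mem x hx =>
    obtain ⟨c, -, rfl⟩ := hx
    by_cases hc : ∀ i, c i < e i
    · exact Submodule.subset_span (by simpa using ⟨c, hc, rfl⟩)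
    · push Not at hc
      rw [Ideal.Quotient.eq_zero_iff_mem.2 (divMonomial_mem_span_range hc he)]
      exact zero_mem _
  | zero => simp
  | add x y _ _ hx hy => rw [map_add]; exact add_mem hx hy
  | smul r x _ hx =>
    have : Ideal.Quotient.mk (Ideal.span (Set.range g)) (r • x) =
      r • Ideal.Quotient.mk (Ideal.span (Set.range g)) x := rfl
    rw [this]; exact Submodule.smul_mem _ _ hx

end Triangular

/-! ### Real characters of odd-dimensional algebras, and even polynomials -/

/-- A commutative real algebra acting on a real vector space of finite odd dimension has a
real character that kills the annihilator of the space: a composition series of the space has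
factors of dimension one or two, according to the residue field `ℝ` or `ℂ`, so one of them has
dimension one. -/
theorem exists_algHom_real_of_odd_finrank {A : Type*} [CommRing A] [Algebra ℝ A] (N : ℕ) :
    ∀ (V : Type*) [AddCommGroup V] [Module ℝ V] [Module A V] [IsScalarTower ℝ A V]
      [Module.Finite ℝ V], Module.finrank ℝ V = N → Odd N →
      ∃ φ : A →ₐ[ℝ] ℝ, ∀ a : A, (∀ v : V, a • v = 0) → φ a = 0 := by
  induction N using Nat.strong_induction_on with
  | _ N ih =>
    intro V _ _ _ _ _ hN hodd
    have : Nontrivial V := by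
      apply Module.nontrivial_of_finrank_pos (R := ℝ)
      rw [hN]; exact hodd.pos
    have : IsArtinian A V := isArtinian_of_tower ℝ inferInstance
    obtain ⟨W, hW⟩ := IsAtomic.exists_atom (Submodule A V)
    have hWs : IsSimpleModule A W := isSimpleModule_iff_isAtom.2 hW
    obtain ⟨m, hm, ⟨ε⟩⟩ := isSimpleModule_iff_quot_maximal.1 hWs
    have hfinW : Module.Finite ℝ W :=
      inferInstanceAs (Module.Finite ℝ (W.restrictScalars ℝ))
    let ε' : W ≃ₗ[ℝ] A ⧸ m := ε.restrictScalars ℝ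
    have hfin : Module.Finite ℝ (A ⧸ m) := Module.Finite.equiv ε'
    let _ : Field (A ⧸ m) := Ideal.Quotient.field m
    have hann : ∀ a : A, (∀ v : V, a • v = 0) → Ideal.Quotient.mk m a = 0 := by
      intro a ha
      obtain ⟨v, hv⟩ := ε.surjective 1
      have h1 : a • ε v = 0 := by
        rw [← map_smul, show a • v = 0 from Subtype.ext (ha v), map_zero]
      rw [hv, Algebra.smul_def, mul_one] at h1
      exact h1
    rcases Real.nonempty_algEquiv_or (A ⧸ m) with ⟨⟨ψ⟩⟩ | ⟨⟨ψ⟩⟩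
    · refine ⟨(ψ : (A ⧸ m) →ₐ[ℝ] ℝ).comp (Ideal.Quotient.mkₐ ℝ m), fun a ha => ?_⟩
      simp [hann a ha]
    · have h2 : Module.finrank ℝ W = 2 := by
        rw [ε'.finrank_eq, ψ.toLinearEquiv.finrank_eq, Complex.finrank_real_complex]
      have h3 : Module.finrank ℝ (V ⧸ W) + Module.finrank ℝ W = N := by
        rw [← hN]
        exact Submodule.finrank_quotient_add_finrank (W.restrictScalars ℝ)
      have hfinQ : Module.Finite ℝ (V ⧸ W) :=
        inferInstanceAs (Module.Finite ℝ (V ⧸ W.restrictScalars ℝ))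
      obtain ⟨φ, hφ⟩ := ih (N - 2) (by omega) (V ⧸ W) (by omega)
        (by rw [← h3, h2] at hodd ⊢; simpa [Nat.odd_add] using hodd)
      refine ⟨φ, fun a ha => hφ a fun v => ?_⟩
      obtain ⟨v, rfl⟩ := Submodule.Quotient.mk_surjective _ v
      rw [← Submodule.Quotient.mk_smul, ha, Submodule.Quotient.mk_zero]

theorem exists_algHom_real_of_odd_finrank_quotient {A : Type*} [CommRing A] [Algebra ℝ A]
    (J : Ideal A) [Module.Finite ℝ (A ⧸ J)] (hodd : Odd (Module.finrank ℝ (A ⧸ J))) :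
    ∃ φ : A →ₐ[ℝ] ℝ, ∀ a ∈ J, φ a = 0 := by
  obtain ⟨φ, hφ⟩ := exists_algHom_real_of_odd_finrank (A := A) _ (A ⧸ J) rfl hodd
  refine ⟨φ, fun a ha => hφ a fun x => ?_⟩
  obtain ⟨q, rfl⟩ := Ideal.Quotient.mk_surjective x
  change Ideal.Quotient.mk J (a * q) = 0
  rw [Ideal.Quotient.eq_zero_iff_mem]
  exact J.mul_mem_right _ ha

section Parity

variable {σ : Type*}

/-- All monomials of `p` have even total degree (`a = 0`), or all have odd degree (`a = 1`). -/
abbrev HasParity (p : MvPolynomial σ ℝ) (a : ZMod 2) : Prop :=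
  IsWeightedHomogeneous (1 : σ → ZMod 2) p a

/-- The subalgebra of the polynomials all of whose monomials have even total degree. -/
noncomputable def evenSubalgebra (σ : Type*) : Subalgebra ℝ (MvPolynomial σ ℝ) where
  carrier := {p | HasParity p 0}
  mul_mem' hp hq := by simpa using IsWeightedHomogeneous.mul hp hq
  add_mem' hp hq := hp.add hq
  algebraMap_mem' r := isWeightedHomogeneous_C _ r

theorem mem_evenSubalgebra {p : MvPolynomial σ ℝ} : p ∈ evenSubalgebra σ ↔ HasParity p 0 :=
  Iff.rfl

theorem hasParity_X (i : σ) : HasParity (X i : MvPolynomial σ ℝ) 1 :=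
  isWeightedHomogeneous_X ℝ _ i

theorem HasParity.mul_of_odd {p q : MvPolynomial σ ℝ} (hp : HasParity p 1) (hq : HasParity q 1) :
    p * q ∈ evenSubalgebra σ := by
  have h := IsWeightedHomogeneous.mul hp hq
  rwa [show (1 : ZMod 2) + 1 = 0 from rfl] at h

/-- A real character `φ` of the algebra of even polynomials with `φ(∑ xᵢ²) = 1` is the evaluation
at a real point `x` of the unit sphere; this is stated for the products of odd polynomials with a
fixed variable. If `φ(xₖ²) = t² > 0`, then `xᵢ = φ(xᵢ xₖ) / t` will do. -/
theorem exists_point_of_even_algHom [Fintype σ] (φ : evenSubalgebra σ →ₐ[ℝ] ℝ)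
    (h1 : ∀ h : ∑ i, X i ^ 2 ∈ evenSubalgebra σ, φ ⟨∑ i, X i ^ 2, h⟩ = 1) :
    ∃ x : σ → ℝ, ∑ i, x i ^ 2 = 1 ∧
      (∃ (k : σ) (t : ℝ), t ≠ 0 ∧ ∀ (p : MvPolynomial σ ℝ) (hp : HasParity p 1),
        φ ⟨X k * p, (hasParity_X k).mul_of_odd hp⟩ = t * eval x p) := by
  let u : σ → σ → ℝ := fun i j => φ ⟨X i * X j, (hasParity_X i).mul_of_odd (hasParity_X j)⟩
  have husum : ∑ i, u i i = 1 := by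
    have hmem : ∑ i, X i ^ 2 ∈ evenSubalgebra σ := by
      refine sum_mem fun i _ => ?_
      rw [pow_two]; exact (hasParity_X i).mul_of_odd (hasParity_X i)
    rw [← h1 hmem, ← map_sum]
    congr 1
    apply Subtype.ext
    simp [pow_two]
  have hmul : ∀ {a b c d : MvPolynomial σ ℝ} (ha : a ∈ evenSubalgebra σ)
      (hb : b ∈ evenSubalgebra σ) (hc : c ∈ evenSubalgebra σ) (hd : d ∈ evenSubalgebra σ),
      a * b = c * d → φ ⟨a, ha⟩ * φ ⟨b, hb⟩ = φ ⟨c, hc⟩ * φ ⟨d, hd⟩ := by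
    intro a b c d ha hb hc hd h
    rw [← map_mul, ← map_mul]
    congr 1
    exact Subtype.ext h
  have hadd : ∀ {a b c : MvPolynomial σ ℝ} (ha : a ∈ evenSubalgebra σ)
      (hb : b ∈ evenSubalgebra σ) (hc : c ∈ evenSubalgebra σ),
      c = a + b → φ ⟨c, hc⟩ = φ ⟨a, ha⟩ + φ ⟨b, hb⟩ := by
    intro a b c ha hb hc h
    rw [← map_add]
    congr 1
    exact Subtype.ext h
  have hzero : ∀ {a : MvPolynomial σ ℝ} (ha : a ∈ evenSubalgebra σ), a = 0 → φ ⟨a, ha⟩ = 0 := by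
    intro a ha h
    rw [← map_zero φ]
    congr 1
    exact Subtype.ext h
  obtain ⟨k, hk⟩ : ∃ k, 0 < u k k := by
    by_contra! h
    have := Finset.sum_nonpos fun i (_ : i ∈ Finset.univ) => h i
    linarith
  set t := Real.sqrt (u k k) with ht
  have ht0 : 0 < t := Real.sqrt_pos.2 hk
  have htt : t * t = u k k := Real.mul_self_sqrt hk.le
  let x : σ → ℝ := fun i => u i k / t
  have hx : ∀ i, u i k = t * x i := fun i => by simp only [x]; field_simp
  refine ⟨x, ?_, k, t, ht0.ne', ?_⟩
  · rw [← husum]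
    refine Finset.sum_congr rfl fun i _ => ?_
    have h2 : u i i * u k k = u i k * u i k := hmul _ _ _ _ (by ring)
    have h3 : x i * t = u i k := by rw [hx]; ring
    have h4 : (x i ^ 2 - u i i) * u k k = 0 := by
      rw [← htt] at h2 ⊢
      linear_combination (x i * t + u i k) * h3 - h2
    have := (mul_eq_zero.1 h4).resolve_right hk.ne'
    linarith
  · have key : ∀ (c : σ →₀ ℕ) (r : ℝ),
        (∃ h : HasParity (monomial c r) 0, φ ⟨monomial c r, h⟩ = eval x (monomial c r)) ∨
        (∃ h : HasParity (monomial c r) 1,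
          φ ⟨X k * monomial c r, (hasParity_X k).mul_of_odd h⟩ = t * eval x (monomial c r)) := by
      refine induction_on_monomial
        (motive := fun p => (∃ h : HasParity p 0, φ ⟨p, h⟩ = eval x p) ∨
          (∃ h : HasParity p 1, φ ⟨X k * p, (hasParity_X k).mul_of_odd h⟩ = t * eval x p))
        (fun a => Or.inl ⟨isWeightedHomogeneous_C _ a, ?_⟩) ?_
      · rw [eval_C]; exact φ.commutes a
      · rintro p i (⟨h, hφ⟩ | ⟨h, hφ⟩)
        · have h' : HasParity (p * X i) 1 := by
            simpa using IsWeightedHomogeneous.mul h (hasParity_X i)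
          refine Or.inr ⟨h', ?_⟩
          have := hmul ((hasParity_X i).mul_of_odd (hasParity_X k)) h
            ((hasParity_X k).mul_of_odd h') (one_mem _) (by ring)
          rw [show φ ⟨1, _⟩ = 1 from map_one φ, mul_one, hφ] at this
          rw [← this, eval_mul, eval_X]
          change u i k * _ = _
          rw [hx]; ring
        · have h' : HasParity (p * X i) 0 := h.mul_of_odd (hasParity_X i)
          refine Or.inl ⟨h', ?_⟩
          have := hmul h' ((hasParity_X k).mul_of_odd (hasParity_X k))
            ((hasParity_X i).mul_of_odd (hasParity_X k)) ((hasParity_X k).mul_of_odd h) (by ring)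
          change _ * u k k = u i k * _ at this
          rw [hφ, hx i] at this
          rw [← htt] at this
          rw [eval_mul, eval_X]
          have htt0 : t * t ≠ 0 := by positivity
          apply mul_right_cancel₀ htt0
          rw [this]; ring
    intro p hp
    induction hp using IsWeightedHomogeneous.induction_on with
    | zero =>
      rw [map_zero]
      exact (hzero _ (mul_zero _)).trans (mul_zero t).symm
    | add p q hp hq hp' hq' =>
      rw [map_add]
      exact (hadd _ _ _ (mul_add _ _ _)).trans (by rw [hp', hq']; ring)
    | monomial d r hr =>
      rcases key d r with ⟨h, -⟩ | ⟨h, hφ⟩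
      · have h0 : monomial d r = 0 := by
          by_contra hne
          exact absurd (IsWeightedHomogeneous.inj_right hne h
            (isWeightedHomogeneous_monomial _ d r hr)) (by decide)
        refine (hzero _ (by rw [h0, mul_zero])).trans ?_
        rw [h0, map_zero, mul_zero]
      · exact hφ

end Parity

/-! ### Odd polynomial systems on the sphere -/

section OddQuotient

theorem hasParity_divMonomial {σ : Type*} [Fintype σ] {e : σ → ℕ} {g : σ → MvPolynomial σ ℝ}
    (hpar : ∀ i, HasParity (g i) (e i)) (c : σ →₀ ℕ) :
    HasParity (divMonomial g e c) (Finsupp.weight (1 : σ → ZMod 2) c) := by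
  have h := IsWeightedHomogeneous.prod (w := (1 : σ → ZMod 2)) Finset.univ _ _
    fun i _ => ((hpar i).pow (c i / e i)).mul ((hasParity_X i).pow (c i % e i))
  convert! h using 1
  rw [Finsupp.weight_eq_sum]
  refine Finset.sum_congr rfl fun i _ => ?_
  simp only [Pi.one_apply, nsmul_eq_mul, mul_one]
  rw [← Nat.cast_mul, ← Nat.cast_add, mul_comm, Nat.div_add_mod]

theorem mem_evenSubalgebra_iff_mem_restrictSupport {σ : Type*} {p : MvPolynomial σ ℝ} :
    p ∈ evenSubalgebra σ ↔
      p ∈ restrictSupport ℝ {c : σ →₀ ℕ | Finsupp.weight (1 : σ → ZMod 2) c = 0} := by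
  rw [mem_restrictSupport_iff, mem_evenSubalgebra]
  exact ⟨fun h c hc => h (mem_support_iff.1 hc), fun h c hc => h (mem_support_iff.2 hc)⟩

variable {κ : Type*} [Fintype κ] {d : ℕ}

/-- The exponent with the components `b i < d`, completed by the component `0` or `1` at `none` that
makes the total degree even. -/
noncomputable def evenExponent (b : κ → Fin d) : Option κ →₀ ℕ :=
  Finsupp.equivFunOnFinite.symm fun o => o.elim ((∑ i, (b i : ℕ)) % 2) fun i => b i

theorem evenExponent_injective : Function.Injective (evenExponent : (κ → Fin d) → _) := by
  intro b b' h
  funext i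
  exact Fin.ext (DFunLike.congr_fun h (some i))

theorem weight_option (c : Option κ →₀ ℕ) :
    Finsupp.weight (1 : Option κ → ZMod 2) c = ((c none + ∑ i, c (some i) : ℕ) : ZMod 2) := by
  rw [Finsupp.weight_eq_sum, Fintype.sum_option]
  simp

theorem weight_evenExponent (b : κ → Fin d) :
    Finsupp.weight (1 : Option κ → ZMod 2) (evenExponent b) = 0 := by
  rw [weight_option, ZMod.natCast_eq_zero_iff_even]
  simp only [evenExponent, Finsupp.equivFunOnFinite_symm_apply_apply, Option.elim]
  rcases Nat.even_or_odd (∑ i, (b i : ℕ)) with h | h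
  · rw [Nat.even_iff.1 h, zero_add]; exact h
  · rw [Nat.odd_iff.1 h, add_comm]; exact h.add_one

variable {w : Option κ → ℕ} {e : Option κ → ℕ} {g : Option κ → MvPolynomial (Option κ) ℝ}

theorem exists_evenExponent_eq (he0 : e none = 2) (he : ∀ i, e (some i) = d) {c : Option κ →₀ ℕ}
    (hc : Finsupp.weight (1 : Option κ → ZMod 2) c = 0) (hlt : ∀ i, c i < e i) :
    ∃ b : κ → Fin d, evenExponent b = c := by
  refine ⟨fun i => ⟨c (some i), he i ▸ hlt (some i)⟩, ?_⟩
  ext o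
  cases o with
  | some i => rfl
  | none =>
    rw [weight_option, ZMod.natCast_eq_zero_iff_even, Nat.even_iff] at hc
    have := hlt none
    rw [he0] at this
    change (∑ i, c (some i)) % 2 = c none
    omega

/-- The even polynomials modulo the ideal of the `gᵢ` have the odd dimension `d ^ |κ|`: a basis is
given by the even monomials with exponents less than `2` at `none` and less than `d` elsewhere. So
some real character of the algebra of even polynomials kills this ideal. -/
theorem exists_even_algHom (hg : ∀ i, HasLeading w (g i) (Finsupp.single i (e i)))
    (he0 : e none = 2) (he : ∀ i, e (some i) = d) (hd : Odd d)
    (hpar : ∀ i, HasParity (g i) (e i)) :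
    ∃ φ : evenSubalgebra (Option κ) →ₐ[ℝ] ℝ,
      ∀ p : evenSubalgebra (Option κ),
        (p : MvPolynomial (Option κ) ℝ) ∈ Ideal.span (Set.range g) → φ p = 0 := by
  classical
  have hepos : ∀ i, 0 < e i := by
    rintro (_ | i)
    · rw [he0]; norm_num
    · rw [he]; exact hd.pos
  let A := evenSubalgebra (Option κ)
  let J : Ideal A := (Ideal.span (Set.range g)).comap A.val
  have hmem : ∀ b : κ → Fin d, monomial (evenExponent b) (1 : ℝ) ∈ A := fun b =>
    isWeightedHomogeneous_monomial _ _ _ (weight_evenExponent b)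
  have hlt : ∀ (b : κ → Fin d) (i : Option κ), evenExponent b i < e i := by
    rintro b (_ | i)
    · rw [he0]; exact Nat.mod_lt _ (by norm_num)
    · rw [he]; exact (b i).2
  let v : (κ → Fin d) → A ⧸ J := fun b => Ideal.Quotient.mk J ⟨_, hmem b⟩
  have hli : LinearIndependent ℝ v := by
    rw [Fintype.linearIndependent_iff]
    intro l hl
    have h1 : ∑ b, l b • monomial (evenExponent b) (1 : ℝ) ∈ Ideal.span (Set.range g) := by
      have h2 : Ideal.Quotient.mk J (∑ b, l b • ⟨_, hmem b⟩) = 0 := by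
        rw [map_sum, ← hl]; rfl
      rw [Ideal.Quotient.eq_zero_iff_mem, Ideal.mem_comap, map_sum] at h2
      exact h2
    have h3 := span_range_le_span_divMonomial hg hepos h1
    have h4 : ∑ b, l b • monomial (evenExponent b) (1 : ℝ) ∈
        Submodule.span ℝ (divMonomial g e '' {c | ∀ i, c i < e i}) := by
      refine sum_mem fun b _ => Submodule.smul_mem _ _ (Submodule.subset_span ?_)
      exact ⟨evenExponent b, hlt b, divMonomial_of_lt (hlt b)⟩
    have h5 := (linearIndependent_divMonomial hg).disjoint_span_image
      (s := {c | ∀ i, c i < e i}) (t := {c | ∃ i, e i ≤ c i}) (by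
        rw [Set.disjoint_left]
        rintro c hc ⟨i, hi⟩
        exact absurd (hc i) (by simpa using hi))
    have h6 := Submodule.disjoint_def.1 h5 _ h4 h3
    have h7 := (linearIndependent_divMonomial hg).comp (evenExponent (κ := κ) (d := d))
      evenExponent_injective
    rw [Fintype.linearIndependent_iff] at h7
    refine h7 l ?_
    rw [← h6]
    refine Finset.sum_congr rfl fun b _ => ?_
    rw [Function.comp_apply, divMonomial_of_lt (hlt b)]
  have hspan : ⊤ ≤ Submodule.span ℝ (Set.range v) := by
    rintro x -
    obtain ⟨⟨p, hp⟩, rfl⟩ := Ideal.Quotient.mk_surjective x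
    have hpE := restrictSupport_le_span_divMonomial hg _ (fun c hc => by
      rw [← mem_evenSubalgebra_iff_mem_restrictSupport]
      have := hasParity_divMonomial hpar c
      rw [show Finsupp.weight (1 : Option κ → ZMod 2) c = 0 from hc] at this
      exact this) (mem_evenSubalgebra_iff_mem_restrictSupport.1 hp)
    suffices h : ∃ h : p ∈ A, Ideal.Quotient.mk J ⟨p, h⟩ ∈ Submodule.span ℝ (Set.range v) from h.2
    clear hp
    induction hpE using Submodule.span_induction with
    | mem x hx =>
      obtain ⟨c, hc, rfl⟩ := hx
      have hA : divMonomial g e c ∈ A := by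
        have := hasParity_divMonomial hpar c
        rw [show Finsupp.weight (1 : Option κ → ZMod 2) c = 0 from hc] at this
        exact this
      refine ⟨hA, ?_⟩
      by_cases hlt : ∀ i, c i < e i
      · obtain ⟨b, rfl⟩ := exists_evenExponent_eq he0 he hc hlt
        refine Submodule.subset_span ⟨b, ?_⟩
        simp only [v]
        congr 1
        exact Subtype.ext (divMonomial_of_lt hlt).symm
      · push Not at hlt
        rw [Ideal.Quotient.eq_zero_iff_mem.2 (show (⟨_, hA⟩ : A) ∈ J from
          divMonomial_mem_span_range hlt hepos)]
        exact zero_mem _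
    | zero => exact ⟨zero_mem _, by
        rw [show (⟨0, zero_mem _⟩ : A) = 0 from rfl, map_zero]; exact zero_mem _⟩
    | add x y _ _ hx hy =>
      obtain ⟨hx, hx'⟩ := hx
      obtain ⟨hy, hy'⟩ := hy
      refine ⟨add_mem hx hy, ?_⟩
      have := add_mem hx' hy'
      rwa [← map_add] at this
    | smul r x _ hx =>
      obtain ⟨hx, hx'⟩ := hx
      exact ⟨A.smul_mem hx r, Submodule.smul_mem _ r hx'⟩
  let B := Module.Basis.mk hli hspan
  have hfin : Module.Finite ℝ (A ⧸ J) := Module.Finite.of_basis B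
  have hrank : Module.finrank ℝ (A ⧸ J) = d ^ Fintype.card κ := by
    rw [Module.finrank_eq_card_basis B]; simp
  obtain ⟨φ, hφ⟩ := exists_algHom_real_of_odd_finrank_quotient J (by rw [hrank]; exact hd.pow)
  exact ⟨φ, fun p hp => hφ p hp⟩

/-- Odd polynomials `Fᵢ`, fewer in number than the variables, and each perturbed by a high odd
power of its own variable, have a common zero on the unit sphere. -/
theorem exists_sphere_zero_add_pow (F : κ → MvPolynomial (Option κ) ℝ)
    (hF : ∀ i, HasParity (F i) 1) (hd : Odd d) (hdF : ∀ i, 2 * (F i).totalDegree < d) :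
    ∃ x : Option κ → ℝ, ∑ o, x o ^ 2 = 1 ∧ ∀ i, x (some i) ^ d + eval x (F i) = 0 := by
  classical
  -- The double weight of the variable `none` makes its square dominate the other squares.
  let w : Option κ → ℕ := fun o => o.elim 2 fun _ => 1
  let e : Option κ → ℕ := fun o => o.elim 2 fun _ => d
  let g : Option κ → MvPolynomial (Option κ) ℝ := fun o =>
    o.elim (∑ o, X o ^ 2 - 1) fun i => X (some i) ^ d + F i
  have hsumsq : HasParity (∑ o : Option κ, X o ^ 2 : MvPolynomial (Option κ) ℝ) 0 := by
    refine (evenSubalgebra (Option κ)).sum_mem fun i _ => ?_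
    rw [pow_two]; exact (hasParity_X i).mul_of_odd (hasParity_X i)
  have hpar : ∀ o, HasParity (g o) (e o) := by
    rintro (_ | i)
    · change HasParity (∑ o, X o ^ 2 - 1) ((2 : ℕ) : ZMod 2)
      rw [show ((2 : ℕ) : ZMod 2) = 0 from rfl]
      exact hsumsq.sub (isWeightedHomogeneous_one _ _)
    · have h1 : ((d : ℕ) : ZMod 2) = 1 := (ZMod.natCast_eq_one_iff_odd).2 hd
      have h2 := (hasParity_X (some i)).pow d
      rw [nsmul_eq_mul, mul_one] at h2
      change HasParity (X (some i) ^ d + F i) (d : ZMod 2)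
      refine h2.add ?_
      rw [h1]; exact hF i
  have hlead : ∀ o, HasLeading w (g o) (Finsupp.single o (e o)) := by
    rintro (_ | i)
    · have h : g none - monomial (Finsupp.single none 2) 1 = ∑ i : κ, X (some i) ^ 2 - 1 := by
        change (∑ o, X o ^ 2 - 1) - _ = _
        rw [Fintype.sum_option, X_pow_eq_monomial]
        ring
      unfold HasLeading weightLT
      change g none - monomial (Finsupp.single none 2) 1 ∈ _
      rw [h]
      refine sub_mem (sum_mem fun i _ => ?_) ?_
      · rw [X_pow_eq_monomial]
        simp [Finsupp.weight_single, w, e]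
      · rw [← C_1, C_apply, monomial_mem_restrictSupport]
        simp [Finsupp.weight_single, w, e]
    · have h : g (some i) - monomial (Finsupp.single (some i) d) 1 = F i := by
        change X (some i) ^ d + F i - _ = _
        rw [X_pow_eq_monomial]
        ring
      unfold HasLeading weightLT
      change g (some i) - monomial (Finsupp.single (some i) d) 1 ∈ _
      rw [h, mem_restrictSupport_iff]
      intro c hc
      have h1 : c.sum (fun _ n => n) ≤ (F i).totalDegree := le_totalDegree hc
      have h2 : Finsupp.weight w c ≤ 2 * c.sum (fun _ n => n) := by
        rw [Finsupp.weight_eq_sum, Finsupp.sum_fintype _ _ (fun _ => rfl), Finset.mul_sum]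
        refine Finset.sum_le_sum fun o _ => ?_
        rw [smul_eq_mul, mul_comm]
        refine Nat.mul_le_mul_right _ ?_
        cases o <;> simp [w]
      have h3 := hdF i
      simp only [Finsupp.weight_single, w, e, Option.elim, Set.mem_ofPred_eq, smul_eq_mul,
        mul_one] at *
      omega
  obtain ⟨φ, hφ⟩ := exists_even_algHom hlead rfl (fun _ => rfl) hd hpar
  have hgmem : ∀ o, g o ∈ Ideal.span (Set.range g) := fun o =>
    Ideal.subset_span (Set.mem_range_self o)
  obtain ⟨x, hx, k, t, ht, hxt⟩ := exists_point_of_even_algHom φ (fun h => by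
    have h1 := hφ (⟨∑ i, X i ^ 2, h⟩ - 1) (by
      rw [AddSubgroupClass.coe_sub, OneMemClass.coe_one]
      exact hgmem none)
    rw [map_sub, map_one] at h1
    linarith)
  refine ⟨x, hx, fun i => ?_⟩
  have hodd : HasParity (g (some i)) 1 := by
    have h1 : ((d : ℕ) : ZMod 2) = 1 := (ZMod.natCast_eq_one_iff_odd).2 hd
    rw [← h1]; exact hpar (some i)
  have h1 := hxt (g (some i)) hodd
  rw [hφ _ (Ideal.mul_mem_left _ _ (hgmem (some i)))] at h1
  have h2 := (mul_eq_zero.1 h1.symm).resolve_left ht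
  simpa [g] using h2

end OddQuotient

/-! ### The Borsuk–Ulam theorem -/

section BorsukUlam

theorem exists_mvPolynomial_near {ι : Type*} {K : Set (ι → ℝ)} (hK : IsCompact K)
    {f : (ι → ℝ) → ℝ} (hf : ContinuousOn f K) {ε : ℝ} (hε : 0 < ε) :
    ∃ p : MvPolynomial ι ℝ, ∀ x ∈ K, |eval x p - f x| < ε := by
  have : CompactSpace K := isCompact_iff_compactSpace.1 hK
  let c : ι → C(K, ℝ) := fun i => ⟨fun x => x.1 i, (continuous_apply i).comp continuous_subtype_val⟩
  have hsep : (aeval (R := ℝ) c).range.SeparatesPoints := by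
    intro x y hxy
    obtain ⟨i, hi⟩ := Function.ne_iff.1 (Subtype.coe_ne_coe.2 hxy)
    exact ⟨c i, ⟨c i, ⟨X i, by simp⟩, rfl⟩, hi⟩
  obtain ⟨⟨g, p, rfl⟩, hg⟩ :=
    ContinuousMap.exists_mem_subalgebra_near_continuous_of_separatesPoints _ hsep
      (fun x : K => f x.1) (continuousOn_iff_continuous_domRestrict.1 hf) ε hε
  refine ⟨p, fun x hx => ?_⟩
  have h1 := hg ⟨x, hx⟩
  have h2 : (aeval (R := ℝ) c p) ⟨x, hx⟩ = eval x p := by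
    clear hg h1
    induction p using MvPolynomial.induction_on with
    | C a => simp
    | add p q hp hq => simp_all
    | mul_X p i hp => simp_all [c]
  rw [← h2]
  exact h1

theorem exists_odd_part {ι : Type*} (p : MvPolynomial ι ℝ) :
    ∃ F : MvPolynomial ι ℝ, HasParity F 1 ∧
      ∀ x : ι → ℝ, eval x F = (eval x p - eval (-x) p) / 2 := by
  induction p using MvPolynomial.induction_on' with
  | monomial c r =>
    have hneg : ∀ x : ι → ℝ, eval (-x) (monomial c r) =
        (-1) ^ (c.sum fun _ n => n) * eval x (monomial c r) := by
      intro x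
      simp only [eval_monomial, Finsupp.prod, Finsupp.sum, Pi.neg_apply]
      rw [← Finset.prod_pow_eq_pow_sum, mul_left_comm, ← Finset.prod_mul_distrib]
      congr 1
      exact Finset.prod_congr rfl fun i _ => neg_pow _ _
    rcases Nat.even_or_odd (c.sum fun _ n => n) with h | h
    · refine ⟨0, isWeightedHomogeneous_zero _ _ _, fun x => ?_⟩
      rw [hneg, h.neg_one_pow]; simp
    · refine ⟨monomial c r, isWeightedHomogeneous_monomial _ _ _ ?_, fun x => ?_⟩
      · rw [Finsupp.weight_apply]
        simp only [Pi.one_apply, nsmul_eq_mul, mul_one]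
        rw [← ZMod.natCast_eq_one_iff_odd] at h
        rw [← h, Finsupp.sum, Finsupp.sum, Nat.cast_sum]
      · rw [hneg, h.neg_one_pow]; ring
  | add p q hp hq =>
    obtain ⟨F, hF, hFx⟩ := hp
    obtain ⟨G, hG, hGx⟩ := hq
    exact ⟨F + G, hF.add hG, fun x => by rw [map_add, map_add, map_add, hFx, hGx]; ring⟩

theorem isCompact_sphere (ι : Type*) [Fintype ι] : IsCompact {x : ι → ℝ | ∑ i, x i ^ 2 = 1} := by
  refine (isCompact_Icc (a := fun _ : ι => (-1 : ℝ)) (b := fun _ => 1)).of_isClosed_subset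
    (isClosed_eq (by fun_prop) continuous_const) fun x hx => ?_
  have h : ∀ i, x i ^ 2 ≤ 1 := fun i => by
    rw [← show ∑ i, x i ^ 2 = 1 from hx]
    exact Finset.single_le_sum (f := fun i => x i ^ 2) (fun i _ => sq_nonneg _) (Finset.mem_univ i)
  exact ⟨fun i => (abs_le.1 ((sq_le_one_iff_abs_le_one _).1 (h i))).1,
    fun i => (abs_le.1 ((sq_le_one_iff_abs_le_one _).1 (h i))).2⟩

/-- The **Borsuk–Ulam theorem**, for the unit sphere in `κ + 1` variables. -/
theorem exists_sphere_zero_of_odd {κ : Type*} [Fintype κ] {f : (Option κ → ℝ) → κ → ℝ}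
    (hf : ContinuousOn f {x | ∑ i, x i ^ 2 = 1}) (hodd : ∀ x, f (-x) = -f x) :
    ∃ x : Option κ → ℝ, ∑ i, x i ^ 2 = 1 ∧ f x = 0 := by
  have happrox : ∀ ε > 0, ∃ x : Option κ → ℝ, ∑ i, x i ^ 2 = 1 ∧ ∀ i, |f x i| ≤ 2 * ε := by
    intro ε hε
    choose p hp using fun i =>
      exists_mvPolynomial_near (isCompact_sphere (Option κ)) (continuousOn_pi.1 hf i) hε
    choose F hF hFx using fun i => exists_odd_part (p i)
    have hFf : ∀ x : Option κ → ℝ, ∑ i, x i ^ 2 = 1 → ∀ i, |eval x (F i) - f x i| ≤ ε := by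
      intro x hx i
      have h1 := hp i x hx
      have h2 := hp i (-x) (by simpa using hx)
      rw [hodd] at h2
      simp only [Pi.neg_apply] at h2
      rw [hFx]
      rw [abs_lt] at h1 h2
      rw [abs_le]
      constructor <;> linarith
    -- The added powers are at most `1` on the sphere, so at a zero `|Fᵢ| ≤ ε`.
    obtain ⟨x, hx, hx0⟩ := exists_sphere_zero_add_pow (d := 2 * (∑ i, (F i).totalDegree) + 1)
      (fun i => ε⁻¹ • F i) (fun i => Submodule.smul_mem
        (weightedHomogeneousSubmodule ℝ (1 : Option κ → ZMod 2) 1) _ (hF i)) (by simp) (fun i => by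
        have h1 := totalDegree_smul_le ε⁻¹ (F i)
        have h2 := Finset.single_le_sum (f := fun i => (F i).totalDegree)
          (fun i _ => Nat.zero_le _) (Finset.mem_univ i)
        omega)
    refine ⟨x, hx, fun i => ?_⟩
    have h1 := hx0 i
    rw [smul_eval] at h1
    have h2 : eval x (F i) = -(ε * x (some i) ^ (2 * (∑ i, (F i).totalDegree) + 1)) := by
      field_simp at h1
      linarith
    have h3 : |x (some i)| ≤ 1 := by
      rw [← sq_le_one_iff_abs_le_one, ← hx]
      exact Finset.single_le_sum (f := fun i => x i ^ 2) (fun i _ => sq_nonneg _)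
        (Finset.mem_univ _)
    have h4 : |eval x (F i)| ≤ ε := by
      rw [h2, abs_neg, abs_mul, abs_of_pos hε, abs_pow]
      exact mul_le_of_le_one_right hε.le (pow_le_one₀ (abs_nonneg _) h3)
    have h5 := hFf x hx i
    rw [abs_le] at *
    constructor <;> linarith
  obtain ⟨y, hy, -⟩ := happrox 1 one_pos
  obtain ⟨x, hx, hmin⟩ := (isCompact_sphere (Option κ)).exists_isMinOn ⟨y, hy⟩
    (f := fun x => ‖f x‖) hf.norm
  refine ⟨x, hx, norm_eq_zero.1 (le_antisymm (le_of_forall_pos_le_add fun ε hε => ?_)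
    (norm_nonneg _))⟩
  obtain ⟨z, hz, hzε⟩ := happrox (ε / 2) (by positivity)
  refine (hmin hz).trans ?_
  rw [zero_add, Set.mem_ofPred_eq] at *
  exact (pi_norm_le_iff_of_nonneg hε.le).2 fun i => by
    simpa [mul_div_cancel₀] using hzε i

/-- The Borsuk–Ulam theorem for maps into a space of smaller dimension. -/
theorem exists_ne_zero_of_odd {ι κ : Type*} [Fintype ι] [Fintype κ]
    (hcard : Fintype.card κ < Fintype.card ι) {f : (ι → ℝ) → κ → ℝ}
    (hf : ContinuousOn f {0}ᶜ) (hodd : ∀ x, f (-x) = -f x) : ∃ x ≠ 0, f x = 0 := by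
  classical
  obtain ⟨j⟩ : Nonempty (Option κ ↪ ι) :=
    Function.Embedding.nonempty_of_card_le (by rw [Fintype.card_option]; exact hcard)
  let T : (Option κ → ℝ) → ι → ℝ := fun x i => ∑ o, if j o = i then x o else 0
  have hT : Continuous T := by
    refine continuous_pi fun i => continuous_finsetSum _ fun o _ => ?_
    split_ifs <;> fun_prop
  have hTj : ∀ x o, T x (j o) = x o := fun x o => by
    simp only [T, j.injective.eq_iff, Finset.sum_ite_eq', Finset.mem_univ, if_true]
  have hT0 : ∀ x : Option κ → ℝ, ∑ i, x i ^ 2 = 1 → T x ≠ 0 := by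
    intro x hx h
    have : ∀ o, x o = 0 := fun o => by rw [← hTj x o, h]; rfl
    simp [this] at hx
  obtain ⟨x, hx, hfx⟩ := exists_sphere_zero_of_odd (f := fun x => f (T x))
    (hf.comp hT.continuousOn fun x hx => hT0 x hx) (fun x => by
      rw [← hodd]
      congr 1
      funext i
      simp only [T, Pi.neg_apply, ← Finset.sum_neg_distrib]
      exact Finset.sum_congr rfl fun o _ => by split_ifs <;> simp)
  exact ⟨T x, hT0 x hx, hfx⟩

end BorsukUlam

/-! ### Zero sets are null, and cell masses depend continuously on the polynomials -/

section Measure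

theorem volume_zeros_eq_zero {m : ℕ} {Q : MvPolynomial (Fin m) ℝ} (hQ : Q ≠ 0) :
    volume {x : Fin m → ℝ | eval x Q = 0} = 0 := by
  induction m with
  | zero =>
    have : {x : Fin 0 → ℝ | eval x Q = 0} = ∅ := by
      ext x
      rw [eq_C_of_isEmpty Q] at hQ ⊢
      simpa using hQ
    rw [this, measure_empty]
  | succ m ih =>
    let f := finSuccEquiv ℝ m Q
    have hf : f ≠ 0 := by simpa [f] using hQ
    have heval : ∀ (t : ℝ) (y : Fin m → ℝ),
        eval (Fin.cons t y : Fin (m + 1) → ℝ) Q = eval y (Polynomial.eval (C t) f) := by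
      intro t y
      rw [eval_eq_eval_mv_eval', Polynomial.eval_map, ← Polynomial.eval₂_at_apply, eval_C]
    -- In the first variable, `Q` is a nonzero polynomial `f` over the polynomials in the others, so
    -- only finitely many values of that variable make `Q` vanish identically.
    have hroots : {t : ℝ | Polynomial.eval (C t) f = 0}.Finite := by
      refine Set.Finite.preimage (f := (C : ℝ →+* MvPolynomial (Fin m) ℝ))
        (C_injective _ _).injOn (f.rootSet_finite (MvPolynomial (Fin m) ℝ)) |>.subset ?_
      intro t ht
      rw [Set.mem_preimage, Polynomial.mem_rootSet_of_ne hf, Polynomial.coe_aeval_eq_eval]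
      exact ht
    have hmp := volume_preserving_piFinSuccAbove (fun _ : Fin (m + 1) => ℝ) 0
    let S : Set (ℝ × (Fin m → ℝ)) := {p | eval (Fin.cons p.1 p.2 : Fin (m + 1) → ℝ) Q = 0}
    have hcons : Continuous fun p : ℝ × (Fin m → ℝ) => (Fin.cons p.1 p.2 : Fin (m + 1) → ℝ) := by
      refine continuous_pi fun i => ?_
      refine Fin.cases ?_ (fun i => ?_) i
      · simpa using continuous_fst
      · simp only [Fin.cons_succ]
        fun_prop
    have hS : MeasurableSet S :=
      (isClosed_eq ((continuous_eval Q).comp hcons) continuous_const).measurableSet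
    have hpre : {x : Fin (m + 1) → ℝ | eval x Q = 0} =
        MeasurableEquiv.piFinSuccAbove (fun _ : Fin (m + 1) => ℝ) 0 ⁻¹' S := by
      ext x
      simp only [S, Set.mem_preimage, Set.mem_ofPred_eq]
      change _ ↔ eval (Fin.cons (x 0) (Fin.tail x) : Fin (m + 1) → ℝ) Q = 0
      rw [Fin.cons_self_tail]
    rw [hpre, hmp.measure_preimage hS.nullMeasurableSet]
    rw [Measure.volume_eq_prod, Measure.measure_prod_null hS]
    filter_upwards [hroots.countable.ae_notMem volume] with t ht
    have := ih (Q := Polynomial.eval (C t) f) ht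
    simpa only [S, Set.preimage_ofPred_eq, heval, Pi.zero_apply] using this

variable {n : ℕ}

theorem measurePreserving_coords : MeasurePreserving (coords : Space n × ℝ → Fin (n + 1) → ℝ) := by
  have h1 : MeasurePreserving (fun z : Space n × ℝ => (z.2, (z.1 : Fin n → ℝ))) :=
    Measure.measurePreserving_swap.comp
      ((PiLp.volume_preserving_ofLp (Fin n)).prod (MeasurePreserving.id volume))
  have h2 := (volume_preserving_piFinSuccAbove (fun _ : Fin (n + 1) => ℝ) (Fin.last n)).symm
  convert! h2.comp h1 using 1
  funext z
  exact (Fin.insertNth_last' z.2 (z.1 : Fin n → ℝ)).symm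

theorem continuous_coords : Continuous (coords : Space n × ℝ → Fin (n + 1) → ℝ) := by
  refine continuous_pi fun i => ?_
  refine Fin.lastCases ?_ (fun i => ?_) i
  · simpa [coords] using continuous_snd
  · simp only [coords, Fin.snoc_castSucc]
    fun_prop

theorem continuous_value (Q : MvPolynomial (Fin (n + 1)) ℝ) : Continuous (value Q) :=
  (continuous_eval Q).comp continuous_coords

theorem ae_value_ne_zero {Q : MvPolynomial (Fin (n + 1)) ℝ} (hQ : Q ≠ 0) :
    ∀ᵐ z : Space n × ℝ, value Q z ≠ 0 := by
  have h := (measurePreserving_coords (n := n)).measure_preimage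
    (isClosed_eq (continuous_eval Q)
      (continuous_const (y := (0 : ℝ)))).measurableSet.nullMeasurableSet
  rw [volume_zeros_eq_zero hQ] at h
  rw [ae_iff]
  simpa [value] using h

theorem isOpen_cell {s : ℕ} (P : Fin s → MvPolynomial (Fin (n + 1)) ℝ) (σ : Fin s → Bool) :
    IsOpen (cell P σ) := by
  simp only [cell, Set.ofPred_forall]
  refine isOpen_iInter_of_finite fun l => ?_
  split_ifs
  · exact isOpen_lt continuous_const (continuous_value _)
  · exact isOpen_lt (continuous_value _) continuous_const

theorem measurableSet_cell {s : ℕ} (P : Fin s → MvPolynomial (Fin (n + 1)) ℝ) (σ : Fin s → Bool) :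
    MeasurableSet (cell P σ) := (isOpen_cell P σ).measurableSet

/-- The mass of a cell depends continuously on the polynomials, as long as none of them vanishes:
away from the null set where one of the limit polynomials is zero, the signs are locally
constant. -/
theorem tendsto_measure_cell {α : Type*} {L : Filter α} [L.IsCountablyGenerated]
    {ν : Measure (Space n × ℝ)} [IsFiniteMeasure ν] (hν : ν ≪ volume) {s : ℕ}
    {P : α → Fin s → MvPolynomial (Fin (n + 1)) ℝ} {P₀ : Fin s → MvPolynomial (Fin (n + 1)) ℝ}
    (h₀ : ∀ l, P₀ l ≠ 0)
    (hlim : ∀ l z, Tendsto (fun a => value (P a l) z) L (𝓝 (value (P₀ l) z))) (σ : Fin s → Bool) :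
    Tendsto (fun a => ν.real (cell (P a) σ)) L (𝓝 (ν.real (cell P₀ σ))) := by
  refine (ENNReal.tendsto_toReal (measure_ne_top ν _)).comp ?_
  refine tendsto_measure_of_ae_tendsto_indicator_of_isFiniteMeasure L (measurableSet_cell _ _)
    (fun _ => measurableSet_cell _ _) ?_
  have hne : ∀ᵐ z ∂ν, ∀ l, value (P₀ l) z ≠ 0 :=
    ae_all_iff.2 fun l => hν.ae_le (ae_value_ne_zero (h₀ l))
  filter_upwards [hne] with z hz
  have hev : ∀ l, ∀ᶠ a in L, (0 < value (P a l) z ↔ 0 < value (P₀ l) z) ∧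
      (value (P a l) z < 0 ↔ value (P₀ l) z < 0) := by
    intro l
    rcases (hz l).lt_or_gt with h | h
    · filter_upwards [(hlim l z).eventually_lt_const h] with a ha
      simp [ha, h, ha.le.not_gt, h.le.not_gt]
    · filter_upwards [(hlim l z).eventually_const_lt h] with a ha
      simp [ha, h, ha.le.not_gt, h.le.not_gt]
  filter_upwards [eventually_all.2 hev] with a ha
  refine forall_congr' fun l => ?_
  split_ifs
  · exact (ha l).1
  · exact (ha l).2

end Measure

/-! ### Simultaneous bisection by polynomials -/

section Bisection

/-- The polynomial with the coefficients `a`, all of whose exponents are at most `e`. -/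
noncomputable def boxPoly {m e : ℕ} (a : (Fin m → Fin (e + 1)) → ℝ) : MvPolynomial (Fin m) ℝ :=
  ∑ b, monomial (Finsupp.equivFunOnFinite.symm fun i => (b i : ℕ)) (a b)

theorem boxPoly_neg {m e : ℕ} (a : (Fin m → Fin (e + 1)) → ℝ) : boxPoly (-a) = -boxPoly a := by
  simp [boxPoly]

theorem boxPoly_ne_zero {m e : ℕ} {a : (Fin m → Fin (e + 1)) → ℝ} (ha : a ≠ 0) :
    boxPoly a ≠ 0 := by
  classical
  obtain ⟨b, hb⟩ := Function.ne_iff.1 ha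
  intro h
  apply hb
  have h1 := congrArg (coeff (Finsupp.equivFunOnFinite.symm fun i => (b i : ℕ))) h
  rw [boxPoly, coeff_sum, Finset.sum_eq_single b] at h1
  · simpa using h1
  · intro b' _ hbb
    rw [coeff_monomial, if_neg]
    intro h2
    apply hbb
    funext i
    exact Fin.ext (DFunLike.congr_fun h2 i)
  · simp

theorem totalDegree_boxPoly_le {m e : ℕ} (a : (Fin m → Fin (e + 1)) → ℝ) :
    (boxPoly a).totalDegree ≤ m * e := by
  refine totalDegree_finsetSum_le fun b _ => ?_
  refine (totalDegree_monomial_le _ _).trans ?_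
  rw [Finsupp.sum_fintype _ _ (fun _ => rfl)]
  calc ∑ i, (b i : ℕ) ≤ ∑ _i : Fin m, e := Finset.sum_le_sum fun i _ => Nat.lt_succ_iff.1 (b i).2
    _ = m * e := by simp

theorem continuous_eval_boxPoly {m e : ℕ} (x : Fin m → ℝ) :
    Continuous fun a : (Fin m → Fin (e + 1)) → ℝ => eval x (boxPoly a) := by
  simp only [boxPoly, map_sum, eval_monomial]
  fun_prop

variable {n : ℕ}

theorem value_neg (Q : MvPolynomial (Fin (n + 1)) ℝ) (z : Space n × ℝ) :
    value (-Q) z = -value Q z := by simp [value]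

theorem mem_cell_snoc {s : ℕ} (P : Fin s → MvPolynomial (Fin (n + 1)) ℝ)
    (Q : MvPolynomial (Fin (n + 1)) ℝ) (σ : Fin s → Bool) (b : Bool) (z : Space n × ℝ) :
    z ∈ cell (Fin.snoc P Q : Fin (s + 1) → _) (Fin.snoc σ b : Fin (s + 1) → Bool) ↔
      z ∈ cell P σ ∧ if b = true then 0 < value Q z else value Q z < 0 := by
  simp only [cell, Set.mem_ofPred_eq]
  rw [Fin.forall_fin_succ']
  simp only [Fin.snoc_castSucc, Fin.snoc_last]

theorem cell_snoc_neg {s : ℕ} (P : Fin s → MvPolynomial (Fin (n + 1)) ℝ)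
    (Q : MvPolynomial (Fin (n + 1)) ℝ) (σ : Fin s → Bool) (b : Bool) :
    cell (Fin.snoc P (-Q) : Fin (s + 1) → _) (Fin.snoc σ b : Fin (s + 1) → Bool) =
      cell (Fin.snoc P Q : Fin (s + 1) → _) (Fin.snoc σ (!b) : Fin (s + 1) → Bool) := by
  ext z
  rw [mem_cell_snoc, mem_cell_snoc, value_neg]
  cases b <;> simp

theorem measure_cell_eq_add {ν : Measure (Space n × ℝ)} [IsFiniteMeasure ν] (hν : ν ≪ volume)
    {s : ℕ} (P : Fin s → MvPolynomial (Fin (n + 1)) ℝ) {Q : MvPolynomial (Fin (n + 1)) ℝ}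
    (hQ : Q ≠ 0) (σ : Fin s → Bool) :
    ν.real (cell P σ) =
      ν.real (cell (Fin.snoc P Q : Fin (s + 1) → _) (Fin.snoc σ true : Fin (s + 1) → Bool)) +
      ν.real (cell (Fin.snoc P Q : Fin (s + 1) → _) (Fin.snoc σ false : Fin (s + 1) → Bool)) := by
  rw [← measureReal_union ?_ (measurableSet_cell _ _)]
  · refine measureReal_congr ?_
    filter_upwards [hν.ae_le (ae_value_ne_zero hQ)] with z hz
    refine propext ?_
    change z ∈ cell P σ ↔ z ∈ cell _ _ ∨ z ∈ cell _ _
    rw [mem_cell_snoc, mem_cell_snoc, ← and_or_left]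
    simp [hz.lt_or_gt.symm]
  · rw [Set.disjoint_left]
    intro z h1 h2
    rw [mem_cell_snoc] at h1 h2
    simp at h1 h2
    linarith [h1.2, h2.2]

variable {ι : Type*} {ν : ι → Measure (Space n × ℝ)} [∀ i, IsFiniteMeasure (ν i)]
  {Φ : (ι → ℝ) → ℝ}

/-- One step of the partition: by the Borsuk–Ulam theorem in the space of the polynomials with
exponents at most `e`, some polynomial cuts all the `2 ^ s` given cells into two parts of the same
size, if the size of a set is measured by a subadditive continuous function of its masses. -/
theorem exists_bisecting_polynomial [Finite ι] (hν : ∀ i, ν i ≪ volume) (hΦ : Continuous Φ)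
    (hsub : ∀ u v : ι → ℝ, 0 ≤ u → 0 ≤ v → Φ (u + v) ≤ Φ u + Φ v) {s e : ℕ}
    (he : 2 ^ s < (e + 1) ^ (n + 1)) {P : Fin s → MvPolynomial (Fin (n + 1)) ℝ}
    (hP : ∀ l, P l ≠ 0) :
    ∃ Q : MvPolynomial (Fin (n + 1)) ℝ, Q ≠ 0 ∧ Q.totalDegree ≤ (n + 1) * e ∧ ∀ σ b,
      Φ (fun i => (ν i).real (cell P σ)) ≤ 2 * Φ (fun i => (ν i).real
        (cell (Fin.snoc P Q : Fin (s + 1) → _) (Fin.snoc σ b : Fin (s + 1) → Bool))) := by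
  let m : ((Fin (n + 1) → Fin (e + 1)) → ℝ) → (Fin s → Bool) → Bool → ℝ := fun a σ b =>
    Φ fun i => (ν i).real
      (cell (Fin.snoc P (boxPoly a) : Fin (s + 1) → _) (Fin.snoc σ b : Fin (s + 1) → Bool))
  have hne : ∀ a : (Fin (n + 1) → Fin (e + 1)) → ℝ, a ≠ 0 → ∀ l : Fin (s + 1),
      (Fin.snoc P (boxPoly a) : Fin (s + 1) → MvPolynomial (Fin (n + 1)) ℝ) l ≠ 0 := by
    intro a ha l
    refine Fin.lastCases ?_ (fun l => ?_) l
    · simpa using boxPoly_ne_zero ha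
    · simpa using hP l
  have hcont : ∀ σ b, ContinuousOn (fun a => m a σ b) {0}ᶜ := by
    intro σ b a ha
    refine ContinuousAt.continuousWithinAt ?_
    refine (hΦ.tendsto _).comp (tendsto_pi_nhds.2 fun i => ?_)
    refine tendsto_measure_cell (hν i) (hne a ha) (fun l z => ?_) _
    refine Fin.lastCases ?_ (fun l => ?_) l
    · simp only [Fin.snoc_last]
      exact (continuous_eval_boxPoly (coords z)).tendsto a
    · simp
  obtain ⟨a, ha, h0⟩ := exists_ne_zero_of_odd (ι := Fin (n + 1) → Fin (e + 1))
    (κ := Fin s → Bool) (by simpa using he) (f := fun a σ => m a σ true - m a σ false)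
    (continuousOn_pi.2 fun σ => (hcont σ true).sub (hcont σ false)) (fun a => by
      funext σ
      simp only [m, boxPoly_neg, cell_snoc_neg, Pi.neg_apply, Bool.not_true, Bool.not_false]
      ring)
  refine ⟨boxPoly a, boxPoly_ne_zero ha, totalDegree_boxPoly_le a, fun σ b => ?_⟩
  have h1 : m a σ true = m a σ false := sub_eq_zero.1 (congrFun h0 σ)
  have h2 : Φ (fun i => (ν i).real (cell P σ)) ≤ m a σ true + m a σ false := by
    refine le_trans (le_of_eq ?_) (hsub _ _ (fun i => measureReal_nonneg)
      (fun i => measureReal_nonneg))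
    congr 1
    funext i
    exact measure_cell_eq_add (hν i) P (boxPoly_ne_zero ha) σ
  cases b
  · change _ ≤ 2 * m a σ false
    linarith
  · change _ ≤ 2 * m a σ true
    linarith

/-- Repeated bisection: after `s` steps each of the `2 ^ s` cells has at least the fraction
`2 ^ (-s)` of the total size. -/
theorem exists_partitioning_polynomials [Finite ι] (hν : ∀ i, ν i ≪ volume) (hΦ : Continuous Φ)
    (hsub : ∀ u v : ι → ℝ, 0 ≤ u → 0 ≤ v → Φ (u + v) ≤ Φ u + Φ v) {e : ℕ → ℕ}
    (he : ∀ l, 2 ^ l < (e l + 1) ^ (n + 1)) (s : ℕ) :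
    ∃ P : Fin s → MvPolynomial (Fin (n + 1)) ℝ,
      (∀ l, P l ≠ 0 ∧ (P l).totalDegree ≤ (n + 1) * e l) ∧
      ∀ σ, Φ (fun i => (ν i).real Set.univ) ≤ 2 ^ s * Φ (fun i => (ν i).real (cell P σ)) := by
  induction s with
  | zero =>
    refine ⟨fun l => l.elim0, fun l => l.elim0, fun σ => ?_⟩
    have : cell (n := n) (fun l : Fin 0 => l.elim0) σ = Set.univ :=
      Set.eq_univ_of_forall fun z l => l.elim0
    rw [this]; simp
  | succ s ih =>
    obtain ⟨P, hP, hcell⟩ := ih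
    obtain ⟨Q, hQ, hQdeg, hQcell⟩ := exists_bisecting_polynomial hν hΦ hsub (he s)
      (fun l => (hP l).1)
    refine ⟨(Fin.snoc P Q : Fin (s + 1) → _), fun l => ?_, fun σ => ?_⟩
    · refine Fin.lastCases ?_ (fun l => ?_) l
      · simpa using ⟨hQ, hQdeg⟩
      · simpa using hP l
    · have h1 := hcell (Fin.init σ)
      have h2 := hQcell (Fin.init σ) (σ (Fin.last s))
      rw [Fin.snoc_init_self] at h2
      calc _ ≤ _ := h1
        _ ≤ 2 ^ s * _ := mul_le_mul_of_nonneg_left h2 (by positivity)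
        _ = _ := by ring

end Bisection

/-! ### Critical values -/

section CriticalValues

variable {m : ℕ}

/-- The partial derivatives of `P = Q + η ∑ xⱼ^d` have the leading terms `η d xⱼ^(d-1)`, so modulo
the ideal which they generate `P` is integral over `ℝ`, and its critical values are zeros of a
polynomial in one variable. -/
theorem finite_criticalValues_add_pow (Q : MvPolynomial (Fin m) ℝ) {η : ℝ} (hη : η ≠ 0) {d : ℕ}
    (hd : Q.totalDegree + 1 < d) :
    {y : ℝ | ∃ x : Fin m → ℝ, (∀ i, eval x (pderiv i (Q + η • ∑ j, X j ^ d)) = 0) ∧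
      eval x (Q + η • ∑ j, X j ^ d) = y}.Finite := by
  set P := Q + η • ∑ j, X j ^ d with hP
  have hd0 : (d : ℝ) ≠ 0 := Nat.cast_ne_zero.2 (by omega)
  let g : Fin m → MvPolynomial (Fin m) ℝ := fun i => (η * d)⁻¹ • pderiv i P
  have hpd : ∀ i, g i = X i ^ (d - 1) + (η * d)⁻¹ • pderiv i Q := by
    intro i
    have h1 : pderiv i (∑ j : Fin m, X j ^ d : MvPolynomial (Fin m) ℝ) =
        (d : ℝ) • X i ^ (d - 1) := by
      rw [map_sum, Finset.sum_eq_single i]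
      · rw [pderiv_pow, pderiv_X_self, mul_one, smul_eq_C_mul]; simp
      · intro j _ hj
        rw [pderiv_pow, pderiv_X_of_ne hj, mul_zero]
      · simp
    simp only [g, hP]
    rw [map_add, Derivation.map_smul, h1, smul_add, smul_smul, smul_smul, add_comm]
    congr 1
    rw [show (η * d)⁻¹ * η * d = 1 by field_simp, one_smul]
  have hlead : ∀ i, HasLeading (fun _ => 1) (g i) (Finsupp.single i (d - 1)) := by
    intro i
    unfold HasLeading weightLT
    rw [hpd, X_pow_eq_monomial, add_sub_cancel_left]
    refine Submodule.smul_mem _ _ ?_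
    rw [mem_restrictSupport_iff]
    intro c hc
    have h1 : (c + Finsupp.single i 1) ∈ Q.support := by
      rw [SetLike.mem_coe, mem_support_iff, coeff_pderiv] at hc
      exact mem_support_iff.2 (left_ne_zero_of_mul hc)
    have h2 := le_totalDegree h1
    rw [Finsupp.sum_fintype _ _ (fun _ => rfl)] at h2
    have h3 : ∑ j, Finsupp.single i 1 j = 1 := by simp [Finsupp.single_apply]
    simp only [Finsupp.add_apply, Finset.sum_add_distrib, h3] at h2
    rw [Set.mem_ofPred_eq, Finsupp.weight_single, Finsupp.weight_eq_sum]
    simp only [smul_eq_mul, mul_one]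
    omega
  have hfin := finite_quotient_span_range hlead (fun _ => by omega)
  obtain ⟨h, hmonic, hh⟩ := Algebra.IsIntegral.isIntegral (R := ℝ)
    (Ideal.Quotient.mk (Ideal.span (Set.range g)) P)
  have hmem : Polynomial.aeval P h ∈ Ideal.span (Set.range g) := by
    rw [← Ideal.Quotient.eq_zero_iff_mem, ← hh, ← Polynomial.aeval_def]
    exact (Polynomial.aeval_algHom_apply (Ideal.Quotient.mkₐ ℝ (Ideal.span (Set.range g))) P h).symm
  refine (h.rootSet_finite ℝ).subset ?_
  rintro y ⟨x, hx, rfl⟩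
  rw [Polynomial.mem_rootSet_of_ne hmonic.ne_zero]
  have hker : Ideal.span (Set.range g) ≤ RingHom.ker (eval x) := by
    rw [Ideal.span_le]
    rintro _ ⟨i, rfl⟩
    rw [SetLike.mem_coe, RingHom.mem_ker]
    simp only [g, smul_eval, hx, mul_zero]
  have h0 := hker hmem
  rw [RingHom.mem_ker] at h0
  rw [← coe_aeval_eq_eval] at h0 ⊢
  exact (Polynomial.aeval_algHom_apply (aeval x) P h).trans h0

theorem add_pow_ne_zero (Q : MvPolynomial (Fin (m + 1)) ℝ) {η : ℝ} (hη : η ≠ 0) {d : ℕ}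
    (hd : Q.totalDegree < d) : Q + η • ∑ j, X j ^ d ≠ 0 := by
  intro h
  have h1 := congrArg (coeff (Finsupp.single 0 d)) h
  rw [coeff_add, coeff_smul, coeff_sum, Finset.sum_eq_single 0] at h1
  · rw [coeff_eq_zero_of_totalDegree_lt, coeff_X_pow, if_pos rfl] at h1
    · simp at h1; exact hη h1
    · rw [Finsupp.support_single _ (by omega)]; simpa using hd
  · intro j _ hj
    rw [coeff_X_pow, if_neg]
    intro h2
    exact hj ((Finsupp.single_left_inj (by omega)).1 h2)
  · simp

variable {n : ℕ}

/-- The zero set of `Q + c` is smooth unless `-c` is a critical value of `Q`. -/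
theorem ae_isTransverse_perturb {s : ℕ} {Q : Fin s → MvPolynomial (Fin (n + 1)) ℝ}
    (hQ : ∀ l, {y : ℝ | ∃ x : Fin (n + 1) → ℝ, (∀ i, eval x (pderiv i (Q l)) = 0) ∧
      eval x (Q l) = y}.Finite) :
    ∀ᵐ c : Fin s → ℝ, ∀ l, IsTransverseCompleteIntersection ![perturb Q c l] := by
  rw [ae_all_iff]
  intro l
  have h1 : ∀ᵐ y : ℝ, y ∉ Neg.neg ⁻¹' {y : ℝ | ∃ x : Fin (n + 1) → ℝ,
      (∀ i, eval x (pderiv i (Q l)) = 0) ∧ eval x (Q l) = y} :=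
    ((hQ l).preimage neg_injective.injOn).countable.ae_notMem _
  filter_upwards [(Measure.quasiMeasurePreserving_eval (fun _ : Fin s => volume) l).ae h1]
    with c hc z hz
  rw [linearIndependent_unique_iff]
  intro h0
  refine hc ⟨coords z, fun i => ?_, ?_⟩
  · have := congrFun h0 i
    simpa [value, perturb] using this
  · have := hz 0
    simp only [value, perturb, Matrix.cons_val_fin_one, map_add, eval_C] at this
    simp only [Function.eval]
    linarith

end CriticalValues

/-! ### Stable partitions and degree count -/

section StablePartition

variable {n : ℕ} {ι : Type*} {ν : ι → Measure (Space n × ℝ)} [∀ i, IsFiniteMeasure (ν i)]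
  {Φ : (ι → ℝ) → ℝ}

theorem value_perturb {s : ℕ} (Q : Fin s → MvPolynomial (Fin (n + 1)) ℝ) (c : Fin s → ℝ)
    (l : Fin s) (z : Space n × ℝ) : value (perturb Q c l) z = value (Q l) z + c l := by
  simp [value, perturb]

/-- The partition can be chosen to be stable under small changes of the constant terms, and such
that each of its polynomials has only finitely many critical values: a small multiple of a sum of
high powers of the variables is added to each polynomial. -/
theorem exists_stable_partition [Finite ι] (hν : ∀ i, ν i ≪ volume) (hΦ : Continuous Φ)
    (hΦ0 : Φ 0 = 0) (hsub : ∀ u v : ι → ℝ, 0 ≤ u → 0 ≤ v → Φ (u + v) ≤ Φ u + Φ v)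
    (hpos : 0 < Φ fun i => (ν i).real Set.univ) {e : ℕ → ℕ}
    (he : ∀ l, 2 ^ l < (e l + 1) ^ (n + 1)) (s : ℕ) :
    ∃ Q : Fin s → MvPolynomial (Fin (n + 1)) ℝ,
      (∀ l, (Q l).totalDegree ≤ (n + 1) * e l + 2) ∧
      (∃ δ : ℝ, 0 < δ ∧ ∀ c : Fin s → ℝ, (∀ l, |c l| < δ) → ∀ σ,
        (cell (perturb Q c) σ).Nonempty ∧
        Φ (fun i => (ν i).real Set.univ) ≤
          2 * 2 ^ s * Φ (fun i => (ν i).real (cell (perturb Q c) σ))) ∧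
      (∀ᵐ c : Fin s → ℝ, ∀ l, IsTransverseCompleteIntersection ![perturb Q c l]) := by
  obtain ⟨P, hP, hcell⟩ := exists_partitioning_polynomials hν hΦ hsub he s
  set N := Φ fun i => (ν i).real Set.univ with hN
  let P' : ℝ → Fin s → MvPolynomial (Fin (n + 1)) ℝ := fun η l =>
    P l + η • ∑ j, X j ^ ((P l).totalDegree + 2)
  have hlim : ∀ σ, Tendsto (fun η => 2 * 2 ^ s * Φ fun i => (ν i).real (cell (P' η) σ)) (𝓝[≠] 0)
      (𝓝 (2 * 2 ^ s * Φ fun i => (ν i).real (cell P σ))) := by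
    intro σ
    refine ((hΦ.tendsto _).comp (tendsto_pi_nhds.2 fun i => ?_)).const_mul _
    refine tendsto_measure_cell (hν i) (fun l => (hP l).1) (fun l z => ?_) σ
    refine tendsto_nhdsWithin_of_tendsto_nhds ?_
    have hc : Continuous fun η : ℝ => value (P' η l) z := by
      simp only [value, P', map_add, smul_eval]
      fun_prop
    simpa [P'] using hc.tendsto 0
  have hev : ∀ᶠ η in 𝓝[≠] (0 : ℝ), ∀ σ,
      N < 2 * 2 ^ s * Φ fun i => (ν i).real (cell (P' η) σ) := by
    refine eventually_all.2 fun σ => (hlim σ).eventually_const_lt ?_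
    have := hcell σ
    linarith
  obtain ⟨η, hη, hη0⟩ := (hev.and self_mem_nhdsWithin).exists
  have hQ0 : ∀ l, P' η l ≠ 0 := fun l => add_pow_ne_zero _ hη0 (by omega)
  have hlim' : ∀ σ, Tendsto
      (fun c : Fin s → ℝ => 2 * 2 ^ s * Φ fun i => (ν i).real (cell (perturb (P' η) c) σ)) (𝓝 0)
      (𝓝 (2 * 2 ^ s * Φ fun i => (ν i).real (cell (P' η) σ))) := by
    intro σ
    refine ((hΦ.tendsto _).comp (tendsto_pi_nhds.2 fun i => ?_)).const_mul _
    refine tendsto_measure_cell (hν i) hQ0 (fun l z => ?_) σ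
    simp only [value_perturb]
    have hc : Continuous fun c : Fin s → ℝ => value (P' η l) z + c l := by fun_prop
    simpa using hc.tendsto 0
  have hev' : ∀ᶠ c : Fin s → ℝ in 𝓝 0, ∀ σ,
      N < 2 * 2 ^ s * Φ fun i => (ν i).real (cell (perturb (P' η) c) σ) :=
    eventually_all.2 fun σ => (hlim' σ).eventually_const_lt (hη σ)
  obtain ⟨δ, hδ, hδc⟩ := Metric.eventually_nhds_iff.1 hev'
  refine ⟨P' η, fun l => ?_, ⟨δ, hδ, fun c hc σ => ?_⟩, ?_⟩
  · refine (totalDegree_add _ _).trans (max_le ((hP l).2.trans (by omega)) ?_)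
    refine (totalDegree_smul_le _ _).trans (totalDegree_finsetSum_le fun j _ => ?_)
    rw [totalDegree_X_pow]
    have := (hP l).2
    omega
  · have h := hδc ((dist_pi_lt_iff hδ).2 fun l => by simpa using hc l) σ
    refine ⟨?_, h.le⟩
    rw [Set.nonempty_iff_ne_empty]
    intro h0
    rw [h0] at h
    simp only [measureReal_empty] at h
    rw [show (fun _ : ι => (0 : ℝ)) = 0 from rfl, hΦ0] at h
    linarith
  · exact ae_isTransverse_perturb fun l => finite_criticalValues_add_pow (P l) hη0 (by omega)

theorem cell_perturb_properties {s : ℕ} (Q : Fin s → MvPolynomial (Fin (n + 1)) ℝ)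
    (c : Fin s → ℝ) :
    (∀ σ, IsOpen (cell (perturb Q c) σ)) ∧
      Pairwise (fun σ σ' => Disjoint (cell (perturb Q c) σ) (cell (perturb Q c) σ')) ∧
      ⋃ σ, cell (perturb Q c) σ = {z | value (∏ l, perturb Q c l) z ≠ 0} := by
  refine ⟨isOpen_cell _, fun σ σ' hσ => ?_, ?_⟩
  · obtain ⟨l, hl⟩ := Function.ne_iff.1 hσ
    rw [Set.disjoint_left]
    intro z hz hz'
    have h1 := hz l
    have h2 := hz' l
    cases h : σ l <;> cases h' : σ' l <;> simp_all <;> linarith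
  · ext z
    simp only [Set.mem_iUnion, Set.mem_ofPred_eq, value, map_prod, Finset.prod_ne_zero_iff,
      Finset.mem_univ, true_implies]
    constructor
    · rintro ⟨σ, hσ⟩ l
      have := hσ l
      split_ifs at this
      · exact this.ne'
      · exact this.ne
    · intro h
      refine ⟨fun l => decide (0 < value (perturb Q c l) z), fun l => ?_⟩
      by_cases hl : 0 < value (perturb Q c l) z
      · rw [if_pos (decide_eq_true hl)]; exact hl
      · simp only [hl, decide_false, Bool.false_eq_true, if_false]
        exact lt_of_le_of_ne (not_lt.1 hl) (h l)

end StablePartition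

section Degrees

/-- In dimension `m`, degree `2 ^ (l / m + 1)` in each variable suffices for the `l`-th bisection,
and these degrees add up to less than `m 2 ^ (t + 1)` over the first `m t` bisections. -/
theorem sum_two_pow_div (m t : ℕ) (hm : 0 < m) :
    ∑ l ∈ Finset.range (m * t), 2 ^ (l / m + 1) + 2 * m = m * 2 ^ (t + 1) := by
  induction t with
  | zero => simp [mul_comm]
  | succ t ih =>
    have h1 : ∑ x ∈ Finset.range m, 2 ^ ((m * t + x) / m + 1) = m * 2 ^ (t + 1) := by
      rw [Finset.sum_congr rfl (g := fun _ => 2 ^ (t + 1)), Finset.sum_const, Finset.card_range,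
        smul_eq_mul]
      intro x hx
      rw [Nat.mul_add_div hm, Nat.div_eq_of_lt (Finset.mem_range.1 hx), add_zero]
    rw [mul_add, mul_one, Finset.sum_range_add, h1, pow_succ 2 (t + 1)]
    linarith

theorem two_pow_lt_pow (m l : ℕ) (hm : 0 < m) : 2 ^ l < (2 ^ (l / m + 1) + 1) ^ m := by
  calc 2 ^ l < 2 ^ ((l / m + 1) * m) := by
        refine Nat.pow_lt_pow_right (by norm_num) ?_
        rw [mul_comm]; exact Nat.lt_mul_div_succ l hm
    _ = (2 ^ (l / m + 1)) ^ m := by rw [pow_mul]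
    _ ≤ (2 ^ (l / m + 1) + 1) ^ m := Nat.pow_le_pow_left (Nat.le_succ _) _

/-- The number `2 ^ t` is comparable to `D`, and `C 2 ^ t ≤ D` unless `t = 0`. -/
theorem exists_two_pow_comparable {C D : ℝ} (hC : 1 ≤ C) (hD : 1 ≤ D) :
    ∃ t : ℕ, (t = 0 ∨ C * 2 ^ t ≤ D) ∧ (2 : ℝ) ^ t ≤ D ∧ D ≤ 2 * C * 2 ^ t := by
  have hC0 : 0 < C := by linarith
  have hlt : D / C < ⌊D / C⌋₊ + 1 := Nat.lt_floor_add_one _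
  rcases eq_or_ne ⌊D / C⌋₊ 0 with h | h
  · refine ⟨0, Or.inl rfl, by simpa using hD, ?_⟩
    rw [h, Nat.cast_zero, zero_add, div_lt_one hC0] at hlt
    simp; linarith
  · have h1 : (2 : ℝ) ^ Nat.log 2 ⌊D / C⌋₊ ≤ D / C := by
      refine le_trans ?_ (Nat.floor_le (by positivity))
      exact_mod_cast Nat.pow_log_le_self 2 h
    have h2 : (⌊D / C⌋₊ : ℝ) + 1 ≤ 2 ^ (Nat.log 2 ⌊D / C⌋₊ + 1) := by
      exact_mod_cast Nat.lt_pow_succ_log_self (by norm_num) ⌊D / C⌋₊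
    have h3 : C * 2 ^ Nat.log 2 ⌊D / C⌋₊ ≤ D := by
      rw [le_div_iff₀ hC0] at h1; linarith
    refine ⟨Nat.log 2 ⌊D / C⌋₊, Or.inr h3, ?_, ?_⟩
    · refine le_trans ?_ h3
      exact le_mul_of_one_le_left (by positivity) hC
    · have h4 := (div_lt_iff₀ hC0).1 (hlt.trans_le h2)
      rw [pow_succ] at h4
      linarith

end Degrees

/-! ### The broad norm -/

section BroadNorm

variable {n : ℕ}

theorem broadMass_nonneg (k A : ℕ) (p K M : ℝ) {S : Set (Space n)}
    (τ : Decomposition S (K * M)⁻¹) (f : L2 n) (W : Set (Space n × ℝ)) :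
    0 ≤ broadMass k A p K M τ f W :=
  Real.iInf_nonneg fun _ => Real.iSup_nonneg fun _ =>
    integral_nonneg fun _ => Real.rpow_nonneg (norm_nonneg _) _

variable {k A : ℕ} {p r K M : ℝ} {S S' : Set (Space n)} {T : Set ℝ}
    (τ : Decomposition S (K * M)⁻¹) (B : Decomposition S' K) (I : Decomposition T (K / 2))
    (f : L2 n)

theorem broadNormPow_nonneg (U : Set (Space n × ℝ)) : 0 ≤ broadNormPow k A p r K M τ B I f U :=
  Finset.sum_nonneg fun _ _ => Real.rpow_nonneg (Finset.sum_nonneg fun _ _ =>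
    Real.rpow_nonneg (mul_nonneg (by positivity) (broadMass_nonneg ..)) _) _

/-- The function of the numbers `|U ∩ (B_K × I_K)|` which gives the `p`-th power of the broad norm.
It is extended to negative arguments by the absolute value. -/
noncomputable def broadNormOfMasses (k A : ℕ) (p r : ℝ) {K M : ℝ}
    (τ : Decomposition S (K * M)⁻¹) (B : Decomposition S' K) (I : Decomposition T (K / 2))
    (f : L2 n) (u : Fin B.N × Fin I.N → ℝ) : ℝ :=
  ∑ b, (∑ i, (|u (b, i)| / volume.real (B.piece b ×ˢ I.piece i) *
    broadMass k A p K M τ f (B.piece b ×ˢ I.piece i)) ^ r) ^ (1 / r)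

theorem continuous_broadNormOfMasses (hr : 1 ≤ r) :
    Continuous (broadNormOfMasses k A p r τ B I f) := by
  have hr0 : 0 ≤ r := by linarith
  refine continuous_finsetSum _ fun b _ => ?_
  refine Continuous.rpow_const (continuous_finsetSum _ fun i _ => ?_)
    fun _ => Or.inr (by positivity)
  refine Continuous.rpow_const ?_ fun _ => Or.inr hr0
  fun_prop

theorem broadNormOfMasses_zero (hr : 1 ≤ r) : broadNormOfMasses k A p r τ B I f 0 = 0 := by
  have hr0 : r ≠ 0 := by linarith
  simp [broadNormOfMasses, hr0]

/-- Minkowski's inequality in `ℓ^r` for each `B_K`. -/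
theorem broadNormOfMasses_add_le (hr : 1 ≤ r) {u v : Fin B.N × Fin I.N → ℝ} (hu : 0 ≤ u)
    (hv : 0 ≤ v) : broadNormOfMasses k A p r τ B I f (u + v) ≤
      broadNormOfMasses k A p r τ B I f u + broadNormOfMasses k A p r τ B I f v := by
  simp only [broadNormOfMasses]
  rw [← Finset.sum_add_distrib]
  refine Finset.sum_le_sum fun b _ => ?_
  refine le_trans (le_of_eq ?_) (Real.Lp_add_le_of_nonneg Finset.univ hr
    (fun i _ => mul_nonneg (by positivity) (broadMass_nonneg ..))
    (fun i _ => mul_nonneg (by positivity) (broadMass_nonneg ..)))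
  congr 1
  refine Finset.sum_congr rfl fun i _ => ?_
  rw [Pi.add_apply, abs_of_nonneg (add_nonneg (hu _) (hv _)), abs_of_nonneg (hu _),
    abs_of_nonneg (hv _), add_div, add_mul]

theorem broadNormPow_inter {U E : Set (Space n × ℝ)} (hE : MeasurableSet E) :
    broadNormPow k A p r K M τ B I f (U ∩ E) = broadNormOfMasses k A p r τ B I f fun j =>
      (volume.restrict (U ∩ B.piece j.1 ×ˢ I.piece j.2)).real E := by
  simp only [broadNormPow, broadNormOfMasses]
  refine Finset.sum_congr rfl fun b _ => ?_
  congr 1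
  refine Finset.sum_congr rfl fun i _ => ?_
  rw [measureReal_restrict_apply hE, abs_of_nonneg measureReal_nonneg, Set.inter_comm E,
    Set.inter_right_comm]

theorem volume_piece_lt_top {X : Type*} [PseudoMetricSpace X] [ProperSpace X] [MeasureSpace X]
    [IsFiniteMeasureOnCompacts (volume : Measure X)] {S : Set X} {ρ : ℝ}
    (d : Decomposition S ρ) (j : Fin d.N) : volume (d.piece j) < ⊤ := by
  obtain ⟨x, hx⟩ := d.subset_ball j
  exact (measure_mono hx).trans_lt (isCompact_closedBall x ρ).measure_lt_top

theorem isFiniteMeasure_restrict_piece (U : Set (Space n × ℝ)) (b : Fin B.N) (i : Fin I.N) :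
    IsFiniteMeasure (volume.restrict (U ∩ B.piece b ×ˢ I.piece i)) := by
  refine ⟨?_⟩
  rw [Measure.restrict_apply_univ]
  refine (measure_mono Set.inter_subset_right).trans_lt ?_
  rw [Measure.volume_eq_prod, Measure.prod_prod]
  exact ENNReal.mul_lt_top (volume_piece_lt_top B b) (volume_piece_lt_top I i)

/-- Stable partitions which are fair with respect to the broad norm. -/
theorem exists_partition_broadNormPow (hr : 1 ≤ r) (U : Set (Space n × ℝ)) {e : ℕ → ℕ}
    (he : ∀ l, 2 ^ l < (e l + 1) ^ (n + 1)) (s : ℕ) :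
    ∃ Q : Fin s → MvPolynomial (Fin (n + 1)) ℝ,
      (∀ l, (Q l).totalDegree ≤ (n + 1) * e l + 2) ∧
      (∃ δ : ℝ, 0 < δ ∧ ∀ c : Fin s → ℝ, (∀ l, |c l| < δ) → ∀ σ,
        (cell (perturb Q c) σ).Nonempty ∧
        broadNormPow k A p r K M τ B I f U ≤
          2 * 2 ^ s * broadNormPow k A p r K M τ B I f (U ∩ cell (perturb Q c) σ)) ∧
      (∀ᵐ c : Fin s → ℝ, ∀ l, IsTransverseCompleteIntersection ![perturb Q c l]) := by
  have hU := broadNormPow_inter (k := k) (A := A) (p := p) (r := r) τ B I f (U := U)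
    MeasurableSet.univ
  rw [Set.inter_univ] at hU
  rcases (broadNormPow_nonneg (k := k) (A := A) (p := p) (r := r) τ B I f U).eq_or_lt with h0 | h0
  · -- Any stable partition will do; that of the unit ball has nonempty cells.
    have hfin : IsFiniteMeasure
        (volume.restrict (Metric.closedBall (0 : Space n × ℝ) 1)) :=
      ⟨by rw [Measure.restrict_apply_univ]; exact (isCompact_closedBall _ _).measure_lt_top⟩
    obtain ⟨Q, hdeg, ⟨δ, hδ, hc⟩, hae⟩ := exists_stable_partition (ι := Unit)
      (ν := fun _ => volume.restrict (Metric.closedBall (0 : Space n × ℝ) 1))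
      (Φ := fun u => u ()) (fun _ => Measure.absolutelyContinuous_of_le Measure.restrict_le_self)
      (continuous_apply _) rfl (fun u v _ _ => le_rfl) (by
        rw [measureReal_restrict_apply_univ]
        exact ENNReal.toReal_pos (Metric.measure_closedBall_pos _ _ one_pos).ne'
          (isCompact_closedBall _ _).measure_lt_top.ne) he s
    refine ⟨Q, hdeg, ⟨δ, hδ, fun c hcl σ => ⟨(hc c hcl σ).1, ?_⟩⟩, hae⟩
    rw [← h0]
    exact mul_nonneg (by positivity) (broadNormPow_nonneg ..)
  · have := fun j : Fin B.N × Fin I.N => isFiniteMeasure_restrict_piece B I U j.1 j.2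
    obtain ⟨Q, hdeg, ⟨δ, hδ, hc⟩, hae⟩ := exists_stable_partition
      (ν := fun j : Fin B.N × Fin I.N => volume.restrict (U ∩ B.piece j.1 ×ˢ I.piece j.2))
      (Φ := broadNormOfMasses k A p r τ B I f)
      (fun _ => Measure.absolutelyContinuous_of_le Measure.restrict_le_self)
      (continuous_broadNormOfMasses τ B I f hr) (broadNormOfMasses_zero τ B I f hr)
      (fun u v hu hv => broadNormOfMasses_add_le τ B I f hr hu hv) (hU ▸ h0) he s
    refine ⟨Q, hdeg, ⟨δ, hδ, fun c hcl σ => ⟨(hc c hcl σ).1, ?_⟩⟩, hae⟩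
    rw [hU, broadNormPow_inter τ B I f (measurableSet_cell _ _)]
    exact (hc c hcl σ).2

end BroadNorm

end PolynomialPartition

theorem theorem4p5 (n : ℕ) (hn : 1 ≤ n) :
    -- the constant depends on the dimension only
    ∃ Cn : ℝ, 0 < Cn ∧
      ∀ (k A : ℕ), 1 ≤ k → k ≤ n + 2 →
      ∀ (p r : ℝ), 1 ≤ p → 1 ≤ r →
      ∀ (K M R : ℝ), 0 < K → 0 < M → 0 < R →
      -- the data of the broad norm: caps `τ`, spatial balls `B_K`, time intervals `I_K`
      ∀ (ξ₀ : Space n)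
        (τ : Decomposition (Metric.closedBall ξ₀ M⁻¹) (K * M)⁻¹)
        (B : Decomposition (Metric.closedBall (0 : Space n) R) K)
        (I : Decomposition (Set.Icc (0 : ℝ) R) (K / 2)),
      Pairwise (fun i j => AEDisjoint volume (τ.piece i) (τ.piece j)) →
      (∀ i, (I.piece i).OrdConnected) →
      ∀ f : L2 n, (∀ᵐ ξ : Space n, ξ ∉ Metric.closedBall ξ₀ M⁻¹ → hat f ξ = 0) →
      ∀ U : Set (Space n × ℝ), U ⊆ Metric.closedBall (0 : Space n) R ×ˢ Set.Icc (0 : ℝ) R →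
      ∀ D : ℝ, 1 ≤ D →
      ∃ (s : ℕ) (Q : Fin s → MvPolynomial (Fin (n + 1)) ℝ),
        ((∑ l, (Q l).totalDegree : ℕ) : ℝ) ≤ D ∧
        Cn⁻¹ * D ^ (n + 1) ≤ (2 : ℝ) ^ s ∧ (2 : ℝ) ^ s ≤ Cn * D ^ (n + 1) ∧
        -- for all constants the cells are disjoint open sets with union the complement of `Z(P)`
        (∀ c : Fin s → ℝ,
          (∀ σ, IsOpen (cell (perturb Q c) σ)) ∧
          Pairwise (fun σ σ' => Disjoint (cell (perturb Q c) σ) (cell (perturb Q c) σ')) ∧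
          ⋃ σ, cell (perturb Q c) σ = {z | value (∏ l, perturb Q c l) z ≠ 0}) ∧
        -- for all small constants there are `2 ^ s` nonempty cells, each with its fair share
        (∃ δ : ℝ, 0 < δ ∧ ∀ c : Fin s → ℝ, (∀ l, |c l| < δ) →
          (∀ σ, (cell (perturb Q c) σ).Nonempty) ∧
          ∀ σ, broadNormPow k A p r K M τ B I f U ≤
            Cn * D ^ (n + 1) * broadNormPow k A p r K M τ B I f (U ∩ cell (perturb Q c) σ)) ∧
        -- for almost all constants each `Z(Q_l + c_l)` is a transverse complete intersection
        (∀ᵐ c : Fin s → ℝ, ∀ l, IsTransverseCompleteIntersection ![perturb Q c l]) := by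
  have hm : 0 < n + 1 := n.succ_pos
  -- The degrees of the polynomials for `s = (n + 1) t` add up to at most `C * 2 ^ t`.
  let C : ℝ := 2 * (n + 1) * (n + 2)
  have hC : 1 ≤ C := by
    have : (0 : ℝ) ≤ n := n.cast_nonneg
    simp only [C]; nlinarith
  refine ⟨(2 * C) ^ (n + 1), by positivity, ?_⟩
  intro k A _ _ p r _ hr K M R _ _ _ ξ₀ τ B I _ _ f _ U _ D hD
  obtain ⟨t, ht, htD, hDt⟩ := PolynomialPartition.exists_two_pow_comparable hC hD
  obtain ⟨Q, hdeg, ⟨δ, hδ, hcell⟩, hae⟩ :=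
    PolynomialPartition.exists_partition_broadNormPow (k := k) (A := A) (p := p) τ B I f hr U
      (fun l => PolynomialPartition.two_pow_lt_pow (n + 1) l hm) ((n + 1) * t)
  have hs : (2 : ℝ) ^ ((n + 1) * t) = (2 ^ t) ^ (n + 1) := by rw [mul_comm, pow_mul]
  have hup : (2 : ℝ) ^ ((n + 1) * t) ≤ D ^ (n + 1) := by
    rw [hs]; exact pow_le_pow_left₀ (by positivity) htD _
  -- This absorbs the factor `2` that is lost in the perturbations.
  have hCn : 2 ≤ (2 * C) ^ (n + 1) :=
    (by linarith : 2 ≤ 2 * C).trans (le_self_pow₀ (by linarith) n.succ_ne_zero)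
  have hDpos : 0 < D ^ (n + 1) := by positivity
  refine ⟨(n + 1) * t, Q, ?_, ?_, ?_, PolynomialPartition.cell_perturb_properties Q,
    ⟨δ, hδ, fun c hc => ⟨fun σ => (hcell c hc σ).1, fun σ => ?_⟩⟩, hae⟩
  · rcases ht with rfl | ht
    · rw [Finset.sum_eq_zero fun l _ => absurd l.2 (by simp)]
      simp; linarith
    · refine le_trans ?_ ht
      have h1 : ∑ l, (Q l).totalDegree ≤
          ∑ l : Fin ((n + 1) * t), (n + 2) * 2 ^ ((l : ℕ) / (n + 1) + 1) := by
        refine Finset.sum_le_sum fun l _ => (hdeg l).trans ?_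
        have : 2 ≤ 2 ^ ((l : ℕ) / (n + 1) + 1) := Nat.le_self_pow (Nat.succ_ne_zero _) 2
        nlinarith
      have h2 := PolynomialPartition.sum_two_pow_div (n + 1) t hm
      rw [← Finset.mul_sum, Fin.sum_univ_eq_sum_range (fun l => 2 ^ (l / (n + 1) + 1))] at h1
      have h3 : ∑ l, (Q l).totalDegree ≤ (n + 2) * ((n + 1) * 2 ^ (t + 1)) :=
        h1.trans (Nat.mul_le_mul_left _ (by omega))
      calc ((∑ l, (Q l).totalDegree : ℕ) : ℝ) ≤ ((n + 2) * ((n + 1) * 2 ^ (t + 1)) : ℕ) := by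
            exact_mod_cast h3
        _ = C * 2 ^ t := by push_cast; simp only [C]; ring
  · rw [inv_mul_le_iff₀ (by positivity), hs, ← mul_pow]
    exact pow_le_pow_left₀ (by linarith) hDt _
  · exact hup.trans (le_mul_of_one_le_left hDpos.le (by linarith))
  · refine (hcell c hc σ).2.trans (mul_le_mul_of_nonneg_right ?_
      (PolynomialPartition.broadNormPow_nonneg ..))
    exact mul_le_mul hCn hup (by positivity) (by positivity)
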